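/- Let $X,Y$ be real reflexive Banach spaces, let $Z_1,Z_2$ be real Banach spaces, and let $K\subseteq X$ and $\Lambda\subseteq Y$ be nonempty, closed and convex. Let $B:X\times Y\to\mathbb R$, $\phi:X\to(-\infty,\infty]$, $\gamma_1:X\to Z_1$, $\gamma_2:Y\to Z_2$, $J:Z_1\to\mathbb R$, $L:Z_2\to\mathbb R$, $H:Y\to(0,\infty)$, $F:X\to X^*$ and $G:Y\to Y^*$ be given, and let $D(\phi)=\{x\in X:\phi(x)<\infty\}$. For a locally Lipschitz $h:E\to\mathbb R$ on a Banach space $E$ put $h^0(x;y)=\limsup_{z\to x,\,t\downarrow0}\frac{h(z+ty)-h(z)}{t}$ and $\partial_C h(x)=\{\xi\in E^*:\langle\xi,y\rangle\le h^0(x;y)\ \forall y\in E\}$. An operator $A:E\to E^*$ is hemicontinuous if $\lim_{t\to0_+}\langle A(u+t(v-u)),w\rangle=\langle A(u),w\rangle$ for all $u,v,w\in E$. For $\beta:E\to\mathbb R$, a set-valued operator $A:E\to2^{E^*}$ is $\beta$-relaxed dissipative if $\langle\zeta_y-\zeta_x,y-x\rangle\le\beta(y-x)$ for all $x,y\in E$,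 $\zeta_x\in A(x)$, $\zeta_y\in A(y)$; a single-valued operator is identified with the corresponding set-valued one. Assume the following. * $(H_0')$: $\phi$ is convex and lower semicontinuous with $D(\phi)\cap K\ne\emptyset$. The functionals $J$ and $L$ are locally Lipschitz, with Lipschitz constants $c_x$ near $x\in Z_1$ and $c_y$ near $y\in Z_2$, respectively, such that $\sup_{x\in Z_1}c_x\le\alpha_J$ and $\sup_{y\in Z_2}c_y\le\alpha_L$ for some $\alpha_J,\alpha_L>0$. The operators $\gamma_1,\gamma_2$ are linear and compact. There is $m_H>0$ with $0<H(\sigma)<m_H$ for all $\sigma\in Y$, and $H(\sigma_n)\to H(\sigma)$ whenever $\sigma_n\rightharpoonup\sigma$ weakly in $Y$. * $(H_B)$: $B$ is convex and lower semicontinuous on $X\times Y$. * $F$ satisfies at least one of the following: $(H_F^1)$ $\liminf_{n\to\infty}\langle F(u_n),v-u_n\rangle\ge\langle F(u),v-u\rangle$ whenever $v\in X$ and $u_n\rightharpoonup u$ weakly in $X$; $(H_F^2)$ $F$ is hemicontinuous and $\beta_F$-relaxed dissipative for some concave $\beta_F:X\to\mathbb R$ with $\beta_F(0)\le0$; $(H_F^3)$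 $F$ is hemicontinuous and $u\mapsto F(u)-\gamma_1^*\partial_CJ(\gamma_1(u))$ is $\beta_T$-relaxed dissipative for some concave $\beta_T:X\to\mathbb R$ with $\beta_T(0)\le0$. * $G$ satisfies at least one of the following: $(H_G^1)$ $\liminf_{n\to\infty}\langle G(\sigma_n),\mu-\sigma_n\rangle\ge\langle G(\sigma),\mu-\sigma\rangle$ whenever $\mu\in Y$ and $\sigma_n\rightharpoonup\sigma$ weakly in $Y$; $(H_G^2)$ $G$ is hemicontinuous and $\beta_G$-relaxed dissipative for some concave $\beta_G:Y\to\mathbb R$ with $\beta_G(0)\le0$; $(H_G^3)$ $G$ is hemicontinuous and $\sigma\mapsto G(\sigma)-H(\sigma)\gamma_2^*\partial_CL(\gamma_2(\sigma))$ is $\beta_S$-relaxed dissipative for some concave $\beta_S:Y\to\mathbb R$ with $\beta_S(0)\le0$. * Either $K\times\Lambda$ is bounded, or the coercivity condition $(C)$ holds: there exist $\bar w_0\in K\cap D(\phi)$ and $\bar\tau_0\in\Lambda$ such that $$\frac{2B(u,\sigma)-B(\bar w_0,\sigma)-B(u,\bar\tau_0)+\langle F(u),\bar w_0-u\rangle+\langle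 G(\sigma),\bar\tau_0-\sigma\rangle}{\|(u,\sigma)\|}\to\infty$$ as $\|(u,\sigma)\|:=\sqrt{\|u\|_X^2+\|\sigma\|_Y^2}\to\infty$ with $(u,\sigma)\in K\times\Lambda$. Then there exists $(u,\sigma)\in(K\cap D(\phi))\times\Lambda$ such that for all $v\in K$ and all $\mu\in\Lambda$ $$B(v,\sigma)-B(u,\sigma)+\phi(v)-\phi(u)+J^0(\gamma_1(u);\gamma_1(v-u))\ge\langle F(u),v-u\rangle,$$ $$B(u,\mu)-B(u,\sigma)+H(\sigma)L^0(\gamma_2(\sigma);\gamma_2(\mu-\sigma))\ge\langle G(\sigma),\mu-\sigma\rangle.$$ -/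

import Mathlib

open Filter Topology
open scoped NNReal

noncomputable section

namespace CoupledIneq

/-- A real normed space is reflexive when the canonical embedding into its bidual is onto. -/
def Reflexive (E : Type*) [NormedAddCommGroup E] [NormedSpace ℝ E] : Prop :=
  Function.Surjective (NormedSpace.inclusionInDoubleDual ℝ E)

/-- Weak convergence `x n ⇀ a` of a sequence. -/
def WeaklyTendsto {E : Type*} [NormedAddCommGroup E] [NormedSpace ℝ E]
    (x : ℕ → E) (a : E) : Prop :=
  Tendsto (fun n => toWeakSpace ℝ E (x n)) atTop (𝓝 (toWeakSpace ℝ E a))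

/-- Clarke's generalized directional derivative `h⁰(x; y)`, the upper limit of the difference
quotients `(h (z + t y) - h z) / t` as `z → x` and `t ↓ 0`; it is used for locally Lipschitz `h`
only, where these quotients are bounded near the limit. -/
def clarkeDeriv {E : Type*} [NormedAddCommGroup E] [NormedSpace ℝ E]
    (h : E → ℝ) (x y : E) : ℝ :=
  limsup (fun p : E × ℝ => (h (p.1 + p.2 • y) - h p.1) / p.2) (𝓝 x ×ˢ 𝓝[>] (0 : ℝ))

/-- Clarke's subdifferential `∂_C h(x)`. -/
def clarkeSubdiff {E : Type*} [NormedAddCommGroup E] [NormedSpace ℝ E]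
    (h : E → ℝ) (x : E) : Set (StrongDual ℝ E) :=
  {ξ | ∀ y, ξ y ≤ clarkeDeriv h x y}

/-- `h` has local Lipschitz constants `c x` (near each point `x`) bounded by one `α > 0`. -/
def BoundedLocalLipschitz {E : Type*} [NormedAddCommGroup E] (h : E → ℝ) : Prop :=
  ∃ (c : E → ℝ≥0) (α : ℝ≥0), 0 < α ∧
    (∀ x, ∃ U ∈ 𝓝 x, LipschitzOnWith (c x) h U) ∧ ∀ x, c x ≤ α

/-- Effective domain of an extended real functional. -/
def effDomain {E : Type*} (φ : E → EReal) : Set E := {x | φ x < ⊤}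

/-- Convexity of a functional with values in `(-∞, ∞]`. -/
def ERealConvex {E : Type*} [NormedAddCommGroup E] [NormedSpace ℝ E] (φ : E → EReal) : Prop :=
  ∀ x y : E, ∀ t : ℝ, 0 ≤ t → t ≤ 1 →
    φ (t • x + (1 - t) • y) ≤ (t : EReal) * φ x + ((1 - t : ℝ) : EReal) * φ y

/-- The set-valued operator `A` is `β`-relaxed dissipative. -/
def RelaxedDissipative {E : Type*} [NormedAddCommGroup E] [NormedSpace ℝ E]
    (A : E → Set (StrongDual ℝ E)) (β : E → ℝ) : Prop :=
  ∀ x y : E, ∀ ζx ∈ A x, ∀ ζy ∈ A y, (ζy - ζx) (y - x) ≤ β (y - x)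

/-- There is a concave `β` with `β 0 ≤ 0` for which `A` is `β`-relaxed dissipative. -/
def ConcaveRelaxedDissipative {E : Type*} [NormedAddCommGroup E] [NormedSpace ℝ E]
    (A : E → Set (StrongDual ℝ E)) : Prop :=
  ∃ β : E → ℝ, ConcaveOn ℝ Set.univ β ∧ β 0 ≤ 0 ∧ RelaxedDissipative A β

/-- Hemicontinuity of a single-valued operator into the dual. -/
def Hemicontinuous {E : Type*} [NormedAddCommGroup E] [NormedSpace ℝ E]
    (A : E → StrongDual ℝ E) : Prop :=
  ∀ u v w : E, Tendsto (fun t : ℝ => A (u + t • (v - u)) w) (𝓝[>] 0) (𝓝 (A u w))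

/-- First condition on an operator `A`: for each `v`, the map `u ↦ ⟨A u, v - u⟩` is weakly
(sequentially) lower semicontinuous. The lower limit is taken in the extended reals. -/
def OpCond1 {E : Type*} [NormedAddCommGroup E] [NormedSpace ℝ E]
    (A : E → StrongDual ℝ E) : Prop :=
  ∀ (v u : E) (x : ℕ → E), WeaklyTendsto x u →
    ((A u (v - u) : ℝ) : EReal) ≤ liminf (fun n => ((A (x n) (v - x n) : ℝ) : EReal)) atTop

/-- Second condition: `A` is hemicontinuous and relaxed dissipative. -/
def OpCond2 {E : Type*} [NormedAddCommGroup E] [NormedSpace ℝ E]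
    (A : E → StrongDual ℝ E) : Prop :=
  Hemicontinuous A ∧ ConcaveRelaxedDissipative (fun u => {A u})

/-- Third condition: `A` is hemicontinuous and the set-valued operator
`u ↦ A u - c u • γ* ∂_C h (γ u)` is relaxed dissipative, where `γ* ξ = ξ ∘ γ`. -/
def OpCond3 {E Z : Type*} [NormedAddCommGroup E] [NormedSpace ℝ E]
    [NormedAddCommGroup Z] [NormedSpace ℝ Z]
    (A : E → StrongDual ℝ E) (c : E → ℝ) (γ : E →L[ℝ] Z) (h : Z → ℝ) : Prop :=
  Hemicontinuous A ∧
    ConcaveRelaxedDissipative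
      (fun u => (fun ξ : StrongDual ℝ Z => A u - c u • ξ.comp γ) '' clarkeSubdiff h (γ u))

/-- The Euclidean product norm on `X × Y`. -/
def pairNorm {X Y : Type*} [NormedAddCommGroup X] [NormedAddCommGroup Y] (p : X × Y) : ℝ :=
  Real.sqrt (‖p.1‖ ^ 2 + ‖p.2‖ ^ 2)

/-- The coercivity condition: for some `w₀ ∈ K ∩ D(φ)` and `τ₀ ∈ Λ` the quotient below tends to
`∞` as `‖(u, σ)‖ → ∞` with `(u, σ) ∈ K × Λ`. -/
def Coercive {X Y : Type*} [NormedAddCommGroup X] [NormedSpace ℝ X]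
    [NormedAddCommGroup Y] [NormedSpace ℝ Y] (K : Set X) (Λ : Set Y) (φ : X → EReal)
    (B : X × Y → ℝ) (F : X → StrongDual ℝ X) (G : Y → StrongDual ℝ Y) : Prop :=
  ∃ w₀ ∈ K ∩ effDomain φ, ∃ τ₀ ∈ Λ,
    Tendsto
      (fun p : X × Y =>
        (2 * B (p.1, p.2) - B (w₀, p.2) - B (p.1, τ₀)
          + F p.1 (w₀ - p.1) + G p.2 (τ₀ - p.2)) / pairNorm p)
      (comap pairNorm atTop ⊓ 𝓟 (K ×ˢ Λ)) atTop

/-- `(u, σ)` solves the coupled system of inequalities on `K × Λ`. In the first inequality `φ u` is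
finite (for `φ` with values in `(-∞, ∞]`), while `φ v` may be `∞`. -/
def IsSolution {X Y Z₁ Z₂ : Type*}
    [NormedAddCommGroup X] [NormedSpace ℝ X] [NormedAddCommGroup Y] [NormedSpace ℝ Y]
    [NormedAddCommGroup Z₁] [NormedSpace ℝ Z₁] [NormedAddCommGroup Z₂] [NormedSpace ℝ Z₂]
    (K : Set X) (Λ : Set Y) (B : X × Y → ℝ) (φ : X → EReal)
    (γ₁ : X →L[ℝ] Z₁) (γ₂ : Y →L[ℝ] Z₂) (J : Z₁ → ℝ) (L : Z₂ → ℝ) (H : Y → ℝ)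
    (F : X → StrongDual ℝ X) (G : Y → StrongDual ℝ Y) (u : X) (σ : Y) : Prop :=
  u ∈ K ∩ effDomain φ ∧ σ ∈ Λ ∧
    (∀ v ∈ K,
      ((F u (v - u) : ℝ) : EReal) ≤
        ((B (v, σ) - B (u, σ) : ℝ) : EReal) + (φ v - φ u)
          + (clarkeDeriv J (γ₁ u) (γ₁ (v - u)) : EReal)) ∧
    (∀ μ ∈ Λ,
      G σ (μ - σ) ≤
        B (u, μ) - B (u, σ) + H σ * clarkeDeriv L (γ₂ σ) (γ₂ (μ - σ)))

end CoupledIneq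

end

/-! Put `f u v = -⟨F u, v - u⟩ + J⁰(γ₁ u; γ₁ (v - u))`, let `g` be the analogue for `G` and `H ·
L⁰`, and let `ψ (u, σ) = B (u, σ) + φ u`. It suffices to find one admissible pair `p` with `ψ p ≤ f
p.1 q.1 + g p.2 q.2 + ψ q` for all admissible `q`: changing only one component of `p` makes the
other bifunction vanish, which gives the two inequalities separately (`isSolution_of_joint`).

On a ball this is an equilibrium problem of Ky Fan type (`Reflexive.exists_equilibrium`). Convexity
in `q` and vanishing on the diagonal give the KKM covering property for the sets of `p` that pass
the test against `q`. These sets need not be weakly closed, so `f` and `g` are replaced by larger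
companions (`HasCompanion`) that are weakly sequentially upper semicontinuous and have no larger
slope at the diagonal; testing on short segments, as in Minty's lemma, returns to `f` and `g`. Each
of the three operator conditions supplies a companion, and compactness of `γ₁`, `γ₂` controls the
Clarke terms.

By reflexivity only finite intersections matter, and these are nonempty by the KKM lemma, which is
derived from Scarf's combinatorial lemma (`exists_rainbow`).

Coercivity forces a solution on a large ball to lie in its interior (`Coercive.exists_radius`);
positive homogeneity of `f`, `g` and convexity of `ψ` then remove the ball
(`joint_solution_of_norm_lt`). -/

namespace Scarf

/-! ### Dominant sets and their one-point extensions. -/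

section Dominant

variable {V I α : Type*} [LinearOrder α] {r : I → V → α}

/-- A set `S` is dominant for a family of orders when every point lies below all of `S` in one of
the orders. -/
def Dominant (r : I → V → α) (S : Finset V) : Prop :=
  ∀ y, ∃ i, ∀ x ∈ S, r i y ≤ r i x

theorem Dominant.mono {S R : Finset V} (hR : Dominant r R) (h : S ⊆ R) : Dominant r S := fun y =>
  let ⟨i, hi⟩ := hR y
  ⟨i, fun x hx => hi x (h hx)⟩

/-- Dominance applied to a point of `S` itself makes that point the minimum of `S` in some order, so
the minima exhaust `S`. -/
theorem Dominant.exists_argmin (hr : ∀ i, Function.Injective (r i)) {S : Finset V}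
    (hS : Dominant r S) (hne : S.Nonempty) :
    ∃ a : I → V, (∀ i, a i ∈ S ∧ ∀ x ∈ S, r i (a i) ≤ r i x) ∧ ∀ y ∈ S, ∃ i, a i = y := by
  choose a ha using fun i => S.exists_min_image (r i) hne
  refine ⟨a, ha, fun y hy => ?_⟩
  obtain ⟨i, hi⟩ := hS y
  exact ⟨i, hr i (le_antisymm ((ha i).2 y hy) (hi _ (ha i).1))⟩

/-- Dominance of either extension, tested on the other new point, can only be witnessed by the order
`k`; so the two points bound each other in `r k`. -/
theorem Dominant.insert_unique [DecidableEq V] (hr : ∀ i, Function.Injective (r i)) {S : Finset V} {v w : V}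
    {k : I} (hv : Dominant r (insert v S)) (hw : Dominant r (insert w S))
    (hvk : ∀ c ≠ k, ∃ s ∈ S, r c s < r c v) (hwk : ∀ c ≠ k, ∃ s ∈ S, r c s < r c w) : v = w := by
  have key : ∀ {v w : V}, Dominant r (insert v S) → (∀ c ≠ k, ∃ s ∈ S, r c s < r c w) →
      r k w ≤ r k v := by
    intro v w hv hwk
    obtain ⟨c, hc⟩ := hv w
    by_cases hck : c = k
    · exact hck ▸ hc v (Finset.mem_insert_self v S)
    · obtain ⟨s, hs, hlt⟩ := hwk c hck
      exact absurd (hc s (Finset.mem_insert_of_mem hs)) (not_le.2 hlt)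
  exact hr k (le_antisymm (key hw hvk) (key hv hwk))

variable [Fintype I]

/-- A set with one element fewer than there are orders has the same minimum in two of
the orders. -/
theorem Dominant.exists_collision {S : Finset V} (hcard : S.card + 1 = Fintype.card I)
    {a : I → V} (ha : ∀ i, a i ∈ S) : ∃ i j, i ≠ j ∧ a i = a j := by
  obtain ⟨i, -, j, -, hij, h⟩ := Finset.exists_ne_map_eq_of_card_lt_of_maps_to
    (s := Finset.univ) (t := S) (f := a) (by rw [Finset.card_univ]; omega) (fun i _ => ha i)
  exact ⟨i, j, hij, h⟩

variable [DecidableEq V]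

/-- In a dominant set of full size the minima of the orders are distinct. The new point therefore
has to break the collision between `i` and `j`, by becoming the minimum in one of these two orders.
-/
theorem Dominant.index_of_insert (hr : ∀ i, Function.Injective (r i)) {S : Finset V} {v : V}
    (hv : v ∉ S) (hcard : S.card + 1 = Fintype.card I) (hR : Dominant r (insert v S))
    {a : I → V} (ha : ∀ i, a i ∈ S ∧ ∀ x ∈ S, r i (a i) ≤ r i x) {i j : I} (hij : i ≠ j)
    (haij : a i = a j) :
    ∃ k, (k = i ∨ k = j) ∧ (∀ s ∈ S, r k v ≤ r k s) ∧ ∀ c ≠ k, ∃ s ∈ S, r c s < r c v := by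
  obtain ⟨b, hb, hbs⟩ := hR.exists_argmin hr (Finset.insert_nonempty v S)
  have hinj : Function.Injective b := by
    have := Finset.injOn_of_surjOn_of_card_le (s := Finset.univ) (t := insert v S) b
      (fun i _ => (hb i).1) (fun y hy => by
        obtain ⟨i, hi⟩ := hbs y hy
        exact ⟨i, by simp, hi⟩)
      (by rw [Finset.card_univ, Finset.card_insert_of_notMem hv, hcard])
    exact fun x y h => this (by simp) (by simp) h
  obtain ⟨k, hk⟩ := hbs v (Finset.mem_insert_self v S)
  have hbS : ∀ c ≠ k, b c ∈ S := fun c hc =>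
    (Finset.mem_insert.1 (hb c).1).resolve_left fun h => hc (hinj (h.trans hk.symm))
  refine ⟨k, ?_, fun s hs => hk ▸ (hb k).2 s (Finset.mem_insert_of_mem hs), fun c hc =>
    ⟨b c, hbS c hc, lt_of_le_of_ne ((hb c).2 v (Finset.mem_insert_self v S)) fun h => ?_⟩⟩
  · by_contra! hne
    have key : ∀ c ≠ k, b c = a c := fun c hc =>
      hr c (le_antisymm ((hb c).2 _ (Finset.mem_insert_of_mem (ha c).1)) ((ha c).2 _ (hbS c hc)))
    exact hij (hinj (by rw [key i hne.1.symm, key j hne.2.symm, haij]))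
  · exact hc (hinj ((hr c h).trans hk.symm))

/-- The new point is the `r i`-largest among the points above the minimum of `S` in every other
order. It is not in `S`, since each point of `S` is a minimum in an order other than `i`: where `i`
would be needed, `j` serves instead. -/
theorem Dominant.exists_insert [Fintype V] {S : Finset V} (hS : Dominant r S)
    {a : I → V} (ha : ∀ i, a i ∈ S ∧ ∀ x ∈ S, r i (a i) ≤ r i x) (has : ∀ y ∈ S, ∃ i, a i = y)
    {i j : I} (hij : i ≠ j) (haij : a i = a j) (hM : ∃ y, ∀ c ≠ i, ∃ s ∈ S, r c s < r c y) :
    ∃ x ∉ S, Dominant r (insert x S) ∧ (∀ s ∈ S, r i x ≤ r i s) ∧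
      ∀ c ≠ i, ∃ s ∈ S, r c s < r c x := by
  classical
  obtain ⟨x, hx, hmax⟩ := (Finset.univ.filter fun y => ∀ c ≠ i, ∃ s ∈ S, r c s < r c y).exists_max_image
    (r i) (by obtain ⟨y, hy⟩ := hM; exact ⟨y, by simpa using hy⟩)
  simp only [Finset.mem_filter, Finset.mem_univ, true_and] at hx hmax
  have hxi : ∀ s ∈ S, r i x ≤ r i s := by
    obtain ⟨c, hc⟩ := hS x
    by_cases hci : c = i
    · exact hci ▸ hc
    · obtain ⟨s, hs, hlt⟩ := hx c hci
      exact absurd (hc s hs) (not_le.2 hlt)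
  refine ⟨x, fun hxS => ?_, fun y => ?_, hxi, hx⟩
  · obtain ⟨c, hci, hc⟩ : ∃ c ≠ i, a c = x := by
      obtain ⟨c, hc⟩ := has x hxS
      by_cases hci : c = i
      · exact ⟨j, hij.symm, by rw [← haij, ← hci, hc]⟩
      · exact ⟨c, hci, hc⟩
    obtain ⟨s, hs, hlt⟩ := hx c hci
    exact absurd ((ha c).2 s hs) (not_le.2 (hc ▸ hlt))
  · by_cases hy : ∀ c ≠ i, ∃ s ∈ S, r c s < r c y
    · refine ⟨i, fun z hz => ?_⟩
      rcases Finset.mem_insert.1 hz with rfl | hz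
      · exact hmax y hy
      · exact (hmax y hy).trans (hxi z hz)
    · push Not at hy
      obtain ⟨c, hci, hc⟩ := hy
      refine ⟨c, fun z hz => ?_⟩
      rcases Finset.mem_insert.1 hz with rfl | hz
      · obtain ⟨s, hs, hlt⟩ := hx c hci
        exact (hc s hs).trans hlt.le
      · exact hc z hz

end Dominant

/-! ### Parity of the almost fully labelled facets. -/

section Label

variable {V I : Type*} [DecidableEq V] [Fintype I] [DecidableEq I]

/-- A set of full size whose labels miss a colour has an even number of facets whose labels are
exactly the colours other than `m`. -/
theorem even_card_facets (l : V → I) (m : I) {R : Finset V} (hcard : R.card = Fintype.card I)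
    (hR : R.image l ≠ Finset.univ) (D : Finset (Finset V))
    (hD : ∀ S, S ⊆ R → (S ∈ D ↔ S.card + 1 = Fintype.card I ∧
      S.image l = Finset.univ.erase m)) :
    Even (D.filter (· ⊆ R)).card := by
  rcases (D.filter (· ⊆ R)).eq_empty_or_nonempty with h | ⟨S, hS⟩
  · simp [h]
  obtain ⟨hSD, hSR⟩ := Finset.mem_filter.1 hS
  obtain ⟨hSc, hSl⟩ := (hD S hSR).1 hSD
  obtain ⟨v, hv⟩ : ∃ v, R \ S = {v} := Finset.card_eq_one.1 (by
    rw [Finset.card_sdiff_of_subset hSR]; omega)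
  have hvS : v ∉ S ∧ v ∈ R := by
    have : v ∈ R \ S := hv ▸ Finset.mem_singleton_self v
    exact ⟨(Finset.mem_sdiff.1 this).2, (Finset.mem_sdiff.1 this).1⟩
  have hRS : R = insert v S := by
    rw [← Finset.sdiff_union_of_subset hSR, hv]; rfl
  have hinj : Set.InjOn l S := by
    apply Finset.injOn_of_card_image_eq
    rw [hSl, Finset.card_erase_of_mem (Finset.mem_univ _), Finset.card_univ]; omega
  have hvm : l v ≠ m := by
    rintro h
    apply hR
    rw [hRS, Finset.image_insert, hSl, h, Finset.insert_erase (Finset.mem_univ _)]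
  obtain ⟨w, hwS, hwv⟩ : ∃ w ∈ S, l w = l v := by
    have : l v ∈ S.image l := by rw [hSl]; simp [hvm]
    simpa using this
  have hvw : v ≠ w := fun h => hvS.1 (h ▸ hwS)
  have himR : R.image l = Finset.univ.erase m := by
    rw [hRS, Finset.image_insert, hSl, Finset.insert_eq_of_mem (by simp [hvm])]
  have hcardE : ∀ u ∈ R, (R.erase u).card + 1 = Fintype.card I := fun u hu => by
    rw [Finset.card_erase_add_one hu, hcard]
  -- The only repeated label on `R` is the common one of `v` and `w`, so an injectively labelled
  -- facet must drop one of them.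
  suffices D.filter (· ⊆ R) = {R.erase v, R.erase w} by
    rw [this, Finset.card_pair]
    · exact even_two
    · intro h
      have : w ∈ R.erase v := Finset.mem_erase.2 ⟨hvw.symm, hSR hwS⟩
      rw [h] at this
      simp at this
  ext U
  simp only [Finset.mem_filter, Finset.mem_insert, Finset.mem_singleton]
  constructor
  · rintro ⟨hUD, hUR⟩
    obtain ⟨hUc, hUl⟩ := (hD U hUR).1 hUD
    obtain ⟨u, hu⟩ : ∃ u, R \ U = {u} := Finset.card_eq_one.1 (by
      rw [Finset.card_sdiff_of_subset hUR]; omega)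
    have huU : u ∉ U := by
      have : u ∈ R \ U := hu ▸ Finset.mem_singleton_self u
      exact (Finset.mem_sdiff.1 this).2
    have hRU : R = insert u U := by
      rw [← Finset.sdiff_union_of_subset hUR, hu]; rfl
    have hUe : U = R.erase u := by rw [hRU, Finset.erase_insert huU]
    by_contra! hne
    have huv : u ≠ v := fun h => hne.1 (h ▸ hUe)
    have huw : u ≠ w := fun h => hne.2 (h ▸ hUe)
    have hUinj : Set.InjOn l U := by
      apply Finset.injOn_of_card_image_eq
      rw [hUl, Finset.card_erase_of_mem (Finset.mem_univ _), Finset.card_univ]; omega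
    exact hvw (hUinj (by simp [hUe, huv.symm, hvS.2]) (by simp [hUe, huw.symm, hSR hwS]) hwv.symm)
  · rintro (rfl | rfl)
    · have h : R.erase v = S := by rw [hRS, Finset.erase_insert hvS.1]
      rw [h]; exact ⟨hSD, hSR⟩
    · refine ⟨(hD _ (Finset.erase_subset _ _)).2 ⟨hcardE w (hSR hwS), ?_⟩,
        Finset.erase_subset _ _⟩
      rw [← himR]
      refine Finset.Subset.antisymm (Finset.image_subset_image (Finset.erase_subset _ _)) ?_
      intro c hc
      obtain ⟨u, hu, rfl⟩ := Finset.mem_image.1 hc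
      by_cases huw : u = w
      · exact Finset.mem_image.2 ⟨v, by simp [hvw, hvS.2], by rw [huw, hwv]⟩
      · exact Finset.mem_image.2 ⟨u, by simp [huw, hu], rfl⟩

end Label

/-! ### Scarf's lemma by a door-and-room count. -/

section Slack

variable {T I α : Type*} [Fintype T] [DecidableEq T] [Fintype I] [DecidableEq I] [LinearOrder α]
  {r : I → T ⊕ I → α}

/-- The rooms containing a door `S`. -/
abbrev roomsAbove (r : I → T ⊕ I → α) (S : Finset (T ⊕ I)) : Set (Finset (T ⊕ I)) :=
  {R | Dominant r R ∧ R.card = Fintype.card I ∧ S ⊆ R}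

omit [Fintype T] in
theorem eq_insert_of_subset {V : Type*} [DecidableEq V] {S R : Finset V} {n : ℕ}
    (hS : S.card + 1 = n) (hR : R.card = n) (h : S ⊆ R) : ∃ v ∉ S, R = insert v S := by
  obtain ⟨v, hv⟩ : ∃ v, R \ S = {v} := Finset.card_eq_one.1 (by
    rw [Finset.card_sdiff_of_subset h]; omega)
  have hvm : v ∈ R \ S := hv ▸ Finset.mem_singleton_self v
  refine ⟨v, (Finset.mem_sdiff.1 hvm).2, ?_⟩
  rw [← Finset.sdiff_union_of_subset h, hv]; rfl

/-- A dominant set of codimension one that is not made of slack points lies in two rooms. -/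
theorem exists_pair_rooms (hr : ∀ i, Function.Injective (r i))
    (hhigh : ∀ i j, j ≠ i → ∀ t, r i (.inl t) < r i (.inr j)) {S : Finset (T ⊕ I)}
    (hS : Dominant r S) (hcard : S.card + 1 = Fintype.card I) {t : T} (ht : .inl t ∈ S) :
    ∃ R R', R ≠ R' ∧ roomsAbove r S = {R, R'} := by
  obtain ⟨a, ha, has⟩ := hS.exists_argmin hr ⟨_, ht⟩
  obtain ⟨i, j, hij, haij⟩ := Dominant.exists_collision hcard fun i => (ha i).1
  have hM : ∀ k, ∃ y, ∀ c ≠ k, ∃ s ∈ S, r c s < r c y := fun k =>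
    ⟨.inr k, fun c hc => ⟨_, ht, hhigh c k hc.symm t⟩⟩
  obtain ⟨x, hxS, hxd, hxi, hxM⟩ := hS.exists_insert ha has hij haij (hM i)
  obtain ⟨x', hxS', hxd', hxi', hxM'⟩ := hS.exists_insert ha has hij.symm haij.symm (hM j)
  have hne : x ≠ x' := by
    rintro rfl
    obtain ⟨s, hs, hlt⟩ := hxM j hij.symm
    exact absurd (hxi' s hs) (not_le.2 hlt)
  refine ⟨insert x S, insert x' S, fun h => ?_, ?_⟩
  · have : x ∈ insert x' S := h ▸ Finset.mem_insert_self x S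
    exact (Finset.mem_insert.1 this).elim hne hxS
  ext R
  simp only [Set.mem_ofPred_eq, Set.mem_insert_iff, Set.mem_singleton_iff]
  constructor
  · rintro ⟨hRd, hRc, hSR⟩
    obtain ⟨v, hv, rfl⟩ := eq_insert_of_subset hcard hRc hSR
    obtain ⟨k, rfl | rfl, -, hkM⟩ := hRd.index_of_insert hr hv hcard ha hij haij
    · left; rw [hRd.insert_unique hr hxd hkM hxM]
    · right; rw [hRd.insert_unique hr hxd' hkM hxM']
  · rintro (rfl | rfl)
    · exact ⟨hxd, by rw [Finset.card_insert_of_notMem hxS, hcard], Finset.subset_insert _ _⟩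
    · exact ⟨hxd', by rw [Finset.card_insert_of_notMem hxS', hcard], Finset.subset_insert _ _⟩

/-- The door made of all slack points but one lies in exactly one room. -/
theorem exists_unique_room (hr : ∀ i, Function.Injective (r i))
    (hlow : ∀ i v, r i (.inr i) ≤ r i v)
    (hhigh : ∀ i j, j ≠ i → ∀ t, r i (.inl t) < r i (.inr j)) (hI : 2 ≤ Fintype.card I) (m : I)
    {S : Finset (T ⊕ I)} (hSdef : S = (Finset.univ.erase m).image .inr)
    (hS : Dominant r S) (hcard : S.card + 1 = Fintype.card I) :
    ∃ R, roomsAbove r S = {R} := by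
  have hmem : ∀ c, c ≠ m → .inr c ∈ S := fun c hc => by simp [hSdef, hc]
  have hSinr : ∀ s ∈ S, ∃ c, c ≠ m ∧ s = .inr c := fun s hs => by
    rw [hSdef] at hs
    obtain ⟨c, hc, rfl⟩ := Finset.mem_image.1 hs
    exact ⟨c, Finset.ne_of_mem_erase hc, rfl⟩
  have hne : S.Nonempty := Finset.card_pos.1 (by omega)
  obtain ⟨a, ha, has⟩ := hS.exists_argmin hr hne
  have hac : ∀ c, c ≠ m → a c = .inr c := fun c hc =>
    hr c (le_antisymm ((ha c).2 _ (hmem c hc)) (hlow c _))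
  obtain ⟨j, hjm, haj⟩ : ∃ j, m ≠ j ∧ a m = a j := by
    obtain ⟨i, j, hij, h⟩ := Dominant.exists_collision hcard fun i => (ha i).1
    by_cases hi : i = m
    · exact ⟨j, hi ▸ hij, hi ▸ h⟩
    · by_cases hj : j = m
      · exact ⟨i, hj ▸ hij.symm, hj ▸ h.symm⟩
      · rw [hac i hi, hac j hj] at h
        exact absurd (Sum.inr_injective h) hij
  obtain ⟨x, hxS, hxd, -, hxM⟩ := hS.exists_insert ha has hjm haj ⟨.inr m, fun c hc =>
    ⟨.inr c, hmem c hc, lt_of_le_of_ne (hlow c _) fun h => hc (Sum.inr_injective (hr c h))⟩⟩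
  -- The collision is between `m` and `j`. Extending through `j` is impossible: in the order `m`
  -- grid points lie below every slack point of `S` and `inr j` is the minimum of `S`, while any
  -- other `inr c` is lowest in its own order.
  have hMj : ∀ y, ¬ ∀ c ≠ j, ∃ s ∈ S, r c s < r c y := by
    intro y hy
    rcases y with t | c
    · obtain ⟨s, hs, hlt⟩ := hy m hjm
      obtain ⟨c, hc, rfl⟩ := hSinr s hs
      exact absurd (hhigh m c hc t) (not_lt.2 hlt.le)
    · by_cases hcj : c = j
      · obtain ⟨s, hs, hlt⟩ := hy m hjm
        refine absurd ((ha m).2 s hs) (not_le.2 ?_)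
        rwa [haj, hac j hjm.symm, ← hcj]
      · obtain ⟨s, hs, hlt⟩ := hy c hcj
        exact absurd (hlow c s) (not_le.2 hlt)
  refine ⟨insert x S, ?_⟩
  ext R
  simp only [Set.mem_ofPred_eq, Set.mem_singleton_iff]
  constructor
  · rintro ⟨hRd, hRc, hSR⟩
    obtain ⟨v, hv, rfl⟩ := eq_insert_of_subset hcard hRc hSR
    obtain ⟨k, rfl | rfl, -, hkM⟩ := hRd.index_of_insert hr hv hcard ha hjm haj
    · rw [hRd.insert_unique hr hxd hkM hxM]
    · exact absurd hkM (hMj v)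
  · rintro rfl
    exact ⟨hxd, by rw [Finset.card_insert_of_notMem hxS, hcard], Finset.subset_insert _ _⟩

/-- **Scarf's lemma**: some dominant set of full size carries all labels. -/
theorem exists_rainbow (hr : ∀ i, Function.Injective (r i))
    (hlow : ∀ i v, r i (.inr i) ≤ r i v)
    (hhigh : ∀ i j, j ≠ i → ∀ t, r i (.inl t) < r i (.inr j)) (hI : 2 ≤ Fintype.card I)
    (l : T → I) :
    ∃ R : Finset (T ⊕ I), Dominant r R ∧ R.card = Fintype.card I ∧
      R.image (Sum.elim l id) = Finset.univ := by
  classical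
  by_contra! hno
  obtain ⟨m⟩ : Nonempty I := Fintype.card_pos_iff.1 (by omega)
  obtain ⟨D, hD⟩ : ∃ D : Finset (Finset (T ⊕ I)), ∀ S, S ∈ D ↔ Dominant r S ∧
      S.card + 1 = Fintype.card I ∧ S.image (Sum.elim l id) = Finset.univ.erase m :=
    ⟨(Set.toFinite {S | _}).toFinset, fun S => Set.Finite.mem_toFinset _⟩
  obtain ⟨P, hP⟩ : ∃ P : Finset (Finset (T ⊕ I)), ∀ R, R ∈ P ↔ Dominant r R ∧
      R.card = Fintype.card I :=
    ⟨(Set.toFinite {S | _}).toFinset, fun S => Set.Finite.mem_toFinset _⟩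
  -- Incidences are counted twice. Without a fully labelled room each room contributes an even
  -- number; every door except `S₀` lies in two rooms and `S₀` in one, so the total would also be
  -- odd.
  have hcount : ∑ S ∈ D, (P.filter (S ⊆ ·)).card = ∑ R ∈ P, (D.filter (· ⊆ R)).card := by
    simp only [Finset.card_filter]
    exact Finset.sum_comm
  have hright : Even (∑ R ∈ P, (D.filter (· ⊆ R)).card) := by
    refine Finset.even_sum _ fun R hR => ?_
    obtain ⟨hRd, hRc⟩ := (hP R).1 hR
    refine even_card_facets (Sum.elim l id) m hRc (hno R hRd hRc) D fun S hSR => ?_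
    rw [hD, and_iff_right (hRd.mono hSR)]
  have hrooms : ∀ S, ((P.filter (S ⊆ ·) : Finset _) : Set (Finset (T ⊕ I))) = roomsAbove r S := by
    intro S; ext R; simp [hP, and_assoc]
  obtain ⟨S₀, hS₀⟩ : ∃ S₀ : Finset (T ⊕ I), S₀ = (Finset.univ.erase m).image .inr := ⟨_, rfl⟩
  have hS₀c : S₀.card + 1 = Fintype.card I := by
    rw [hS₀, Finset.card_image_of_injective _ Sum.inr_injective,
      Finset.card_erase_add_one (Finset.mem_univ _), Finset.card_univ]
  have hS₀d : Dominant r S₀ := by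
    rintro (t | c)
    · refine ⟨m, fun x hx => ?_⟩
      rw [hS₀] at hx
      obtain ⟨c, hc, rfl⟩ := Finset.mem_image.1 hx
      exact (hhigh m c (Finset.ne_of_mem_erase hc) t).le
    · exact ⟨c, fun x _ => hlow c x⟩
  have hS₀D : S₀ ∈ D := by
    refine (hD _).2 ⟨hS₀d, hS₀c, ?_⟩
    ext c
    simp [hS₀]
  have hleft : ∀ S ∈ D.erase S₀, Even (P.filter (S ⊆ ·)).card := by
    intro S hS
    obtain ⟨hSne, hSD⟩ := Finset.mem_erase.1 hS
    obtain ⟨hSd, hSc, hSl⟩ := (hD S).1 hSD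
    obtain ⟨t, ht⟩ : ∃ t, .inl t ∈ S := by
      by_contra! hnot
      apply hSne
      have key : ∀ c, .inr c ∈ S ↔ c ≠ m := fun c => by
        have : c ∈ S.image (Sum.elim l id) ↔ c ≠ m := by rw [hSl]; simp
        rw [← this, Finset.mem_image]
        constructor
        · exact fun h => ⟨_, h, rfl⟩
        · rintro ⟨t | d, hx, rfl⟩
          · exact absurd hx (hnot t)
          · exact hx
      ext x
      rcases x with t | c
      · simp [hS₀, hnot t]
      · simp [hS₀, key c]
    obtain ⟨R, R', hne, h⟩ := exists_pair_rooms hr hhigh hSd hSc ht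
    have : P.filter (S ⊆ ·) = {R, R'} := by
      apply Finset.coe_injective; rw [hrooms, h]; simp
    rw [this, Finset.card_pair hne]
    exact even_two
  obtain ⟨R, h⟩ := exists_unique_room hr hlow hhigh hI m hS₀ hS₀d hS₀c
  have hone : (P.filter (S₀ ⊆ ·)).card = 1 := by
    have : P.filter (S₀ ⊆ ·) = {R} := by
      apply Finset.coe_injective; rw [hrooms, h]; simp
    rw [this, Finset.card_singleton]
  rw [← Finset.add_sum_erase _ _ hS₀D, hone] at hcount
  have heven := Finset.even_sum _ hleft
  rw [← hcount] at hright
  exact Nat.not_even_one ((Nat.even_add.1 hright).2 heven)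

end Slack

/-! ### From Scarf's lemma to the KKM lemma. -/

section Simplex

variable {I : Type*} [Fintype I] [DecidableEq I]

/-- Points of the standard simplex with denominator `N`, scaled by `N`. -/
abbrev Grid (I : Type*) [Fintype I] (N : ℕ) : Type _ :=
  {t : I → Fin (N + 1) // ∑ i, (t i : ℕ) = N}

omit [DecidableEq I] in
theorem Grid.exists_eq {N : ℕ} (y : I → ℕ) (hy : ∑ i, y i = N) :
    ∃ t : Grid I N, ∀ i, (t.1 i : ℕ) = y i :=
  ⟨⟨fun i => ⟨y i, Nat.lt_succ_of_le
    (hy ▸ Finset.single_le_sum (fun _ _ => Nat.zero_le _) (Finset.mem_univ i))⟩, hy⟩, fun _ => rfl⟩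

/-- The main coordinate of the `i`-th order on grid points and slack points. -/
def height {N : ℕ} (i : I) : Grid I N ⊕ I → ℤ
  | .inl t => (t.1 i : ℕ)
  -- These values lie below and above all grid coordinates `0, …, N`, as `exists_rainbow` demands.
  | .inr j => if j = i then -1 else N + 1

/-- In some room carrying all labels, any two grid points are less than `card I` apart, and slack
directions are almost absent. -/
theorem exists_small_room (hI : 2 ≤ Fintype.card I) (N : ℕ) (l : Grid I N → I) :
    ∃ (W : Set (Grid I N)), W.Nonempty ∧
      (∀ t ∈ W, ∀ s ∈ W, ∀ i, (t.1 i : ℕ) ≤ s.1 i + Fintype.card I) ∧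
      ∀ i, (∃ t ∈ W, l t = i) ∨ ∀ t ∈ W, (t.1 i : ℕ) ≤ Fintype.card I := by
  classical
  let e := Fintype.equivFin (Grid I N ⊕ I)
  -- An enumeration breaks ties lexicographically, making every order injective.
  let r : I → Grid I N ⊕ I → ℤ ×ₗ Fin (Fintype.card (Grid I N ⊕ I)) :=
    fun i v => toLex (height i v, e v)
  have hgrid : ∀ (t : Grid I N) (i : I), (t.1 i : ℕ) ≤ N := fun t i => Nat.lt_succ_iff.1 (t.1 i).2
  have hr : ∀ i, Function.Injective (r i) := fun i v w h => by
    have := congrArg (fun p => (ofLex p).2) h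
    exact e.injective this
  have hlt : ∀ i v w, height i v < height i w → r i v < r i w := fun i v w h =>
    Prod.Lex.toLex_lt_toLex.2 (Or.inl h)
  have hle : ∀ i v w, r i v ≤ r i w → height i v ≤ height i w := fun i v w h =>
    (Prod.Lex.toLex_le_toLex.1 h).elim (fun h => h.le) fun h => h.1.le
  have hbot : ∀ i (t : Grid I N), height (N := N) i (.inr i) < height i (.inl t) := fun i t => by
    simp only [height, if_pos]; omega
  obtain ⟨R, hRd, -, hRl⟩ := exists_rainbow (r := r) hr
    (fun i v => by
      by_cases hv : v = .inr i
      · rw [hv]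
      · refine (hlt i _ _ ?_).le
        rcases v with t | j
        · exact hbot i t
        · have : j ≠ i := fun h => hv (by rw [h])
          simp only [height, if_pos, if_neg this]; omega)
    (fun i j hj t => hlt i _ _ (by
      have := hgrid t i
      simp only [height, if_neg hj]; omega)) hI l
  have hdom : ∀ y : Grid I N, ∃ i, .inr i ∉ R ∧ ∀ t, .inl t ∈ R → (y.1 i : ℕ) ≤ t.1 i := fun y => by
    obtain ⟨i, hi⟩ := hRd (.inl y)
    refine ⟨i, fun h => absurd (hle i _ _ (hi _ h)) (not_le.2 (hbot i y)), fun t ht => ?_⟩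
    have := hle i _ _ (hi _ ht)
    simpa [height] using this
  have hlab : ∀ i, .inr i ∈ R ∨ ∃ t, .inl t ∈ R ∧ l t = i := fun i => by
    have : i ∈ R.image (Sum.elim l id) := by rw [hRl]; exact Finset.mem_univ i
    obtain ⟨t | j, hv, h⟩ := Finset.mem_image.1 this
    · exact Or.inr ⟨t, hv, h⟩
    · exact Or.inl (by simpa using h ▸ hv)
  obtain ⟨i₀⟩ : Nonempty I := Fintype.card_pos_iff.1 (by omega)
  obtain ⟨j, hj⟩ : ∃ j, .inr j ∉ R := by
    obtain ⟨y, -⟩ := Grid.exists_eq (N := N) (fun i : I => if i = i₀ then N else 0) (by simp)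
    obtain ⟨i, hi, -⟩ := hdom y
    exact ⟨i, hi⟩
  obtain ⟨t₀, ht₀, -⟩ := (hlab j).resolve_left hj
  let W : Finset (Grid I N) := Finset.univ.filter fun t => .inl t ∈ R
  have hW : ∀ t, t ∈ W ↔ .inl t ∈ R := fun t => by simp [W]
  choose w hw hmin using fun i : I =>
    W.exists_min_image (fun t => (t.1 i : ℕ)) ⟨t₀, (hW t₀).2 ht₀⟩
  set C : Finset I := Finset.univ.filter fun i => .inr i ∉ R with hC
  have hjC : j ∈ C := by simp [hC, hj]
  -- Otherwise some grid point exceeds the minimum over `W` in every direction of `C`, which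
  -- contradicts `hdom`.
  have hsum : N < ∑ i ∈ C, (((w i).1 i : ℕ) + 1) := by
    by_contra! hcon
    obtain ⟨y, hy⟩ := Grid.exists_eq (N := N) (fun i : I =>
      (if i ∈ C then ((w i).1 i : ℕ) + 1 else 0) +
        if i = j then N - ∑ i ∈ C, (((w i).1 i : ℕ) + 1) else 0) (by
      rw [Finset.sum_add_distrib, Finset.sum_ite_mem, Finset.univ_inter,
        Finset.sum_ite_eq' Finset.univ j, if_pos (Finset.mem_univ j)]
      omega)
    obtain ⟨i, hi, hyi⟩ := hdom y
    have h1 := hyi (w i) ((hW _).1 (hw i))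
    have h2 := hy i
    rw [if_pos (by simp [hC, hi])] at h2
    omega
  have hCcard : C.card ≤ Fintype.card I := Finset.card_le_univ C
  -- The coordinates of `t` add up to `N`, so `hsum` leaves less than `C.card` for the excess over
  -- the minima on `C` and the coordinates off `C` together.
  have hbound : ∀ t ∈ W, (∀ i ∈ C, (t.1 i : ℕ) ≤ (w i).1 i + Fintype.card I) ∧
      ∀ i, i ∉ C → (t.1 i : ℕ) ≤ Fintype.card I := by
    intro t ht
    have h1 : ∑ i ∈ C, ((w i).1 i : ℕ) + C.card = ∑ i ∈ C, (((w i).1 i : ℕ) + 1) := by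
      rw [Finset.sum_add_distrib]; simp
    have h2 : ∑ i ∈ C, (t.1 i : ℕ) + ∑ i ∈ Cᶜ, (t.1 i : ℕ) = N := by
      rw [Finset.sum_add_sum_compl, t.2]
    constructor
    · intro i hi
      have h3 := Finset.add_sum_erase C (fun i => (t.1 i : ℕ)) hi
      have h4 := Finset.add_sum_erase C (fun i => ((w i).1 i : ℕ)) hi
      have h5 : ∑ k ∈ C.erase i, ((w k).1 k : ℕ) ≤ ∑ k ∈ C.erase i, (t.1 k : ℕ) :=
        Finset.sum_le_sum fun k _ => hmin k t ht
      omega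
    · intro i hi
      have h3 : (t.1 i : ℕ) ≤ ∑ i ∈ Cᶜ, (t.1 i : ℕ) :=
        Finset.single_le_sum (f := fun i => (t.1 i : ℕ)) (fun _ _ => Nat.zero_le _)
          (Finset.mem_compl.2 hi)
      have h5 : ∑ k ∈ C, ((w k).1 k : ℕ) ≤ ∑ k ∈ C, (t.1 k : ℕ) :=
        Finset.sum_le_sum fun k _ => hmin k t ht
      omega
  refine ⟨W, ⟨t₀, (hW t₀).2 ht₀⟩, fun t ht s hs i => ?_, fun i => ?_⟩
  · by_cases hi : i ∈ C
    · have h1 := (hbound t ht).1 i hi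
      have h2 := hmin i s hs
      omega
    · have h1 := (hbound t ht).2 i hi
      omega
  · by_cases hi : i ∈ C
    · obtain ⟨t, ht, h⟩ := (hlab i).resolve_left (by simpa [hC] using hi)
      exact Or.inl ⟨t, (hW t).2 ht, h⟩
    · exact Or.inr fun t ht => (hbound t ht).2 i hi

/-- For every labelling of the simplex there is a point near which each label occurs, except those
whose coordinate is small. -/
theorem exists_approx (hI : 2 ≤ Fintype.card I) (c : (I → ℝ) → I) {ε : ℝ} (hε : 0 < ε) :
    ∃ x ∈ stdSimplex ℝ I, ∀ i, (∃ y ∈ stdSimplex ℝ I, dist y x ≤ ε ∧ c y = i) ∨ x i ≤ ε := by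
  obtain ⟨N, hN⟩ := exists_nat_gt (Fintype.card I / ε)
  have hNpos : (0 : ℝ) < N := lt_of_le_of_lt (by positivity) hN
  have hnε : (Fintype.card I : ℝ) / N ≤ ε := by
    rw [div_lt_iff₀ hε] at hN
    rw [div_le_iff₀ hNpos]
    linarith
  let pt : Grid I N → I → ℝ := fun t i => (t.1 i : ℕ) / (N : ℝ)
  have hpt : ∀ t, pt t ∈ stdSimplex ℝ I := fun t => by
    refine ⟨fun i => by positivity, ?_⟩
    simp only [pt]
    rw [← Finset.sum_div, ← Nat.cast_sum, t.2, div_self hNpos.ne']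
  obtain ⟨W, ⟨t₀, ht₀⟩, hclose, hlab⟩ := exists_small_room hI N fun t => c (pt t)
  refine ⟨pt t₀, hpt t₀, fun i => (hlab i).imp ?_ fun h => ?_⟩
  · rintro ⟨t, ht, h⟩
    refine ⟨pt t, hpt t, (dist_pi_le_iff hε.le).2 fun k => ?_, h⟩
    have h1 : ((t.1 k : ℕ) : ℝ) ≤ (t₀.1 k : ℕ) + Fintype.card I := by
      exact_mod_cast hclose t ht t₀ ht₀ k
    have h2 : ((t₀.1 k : ℕ) : ℝ) ≤ (t.1 k : ℕ) + Fintype.card I := by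
      exact_mod_cast hclose t₀ ht₀ t ht k
    refine le_trans ?_ hnε
    simp only [pt, Real.dist_eq]
    rw [← sub_div, abs_div, abs_of_pos hNpos]
    gcongr
    exact abs_le.2 ⟨by linarith, by linarith⟩
  · refine le_trans ?_ hnε
    simp only [pt]
    gcongr
    exact_mod_cast h t₀ ht₀

/-- If at each point of the simplex one of the continuous functions `g i` is nonnegative, then at
some point each `g i` is nonnegative unless the `i`-th coordinate vanishes. -/
theorem exists_complementary [Nonempty I] {g : I → (I → ℝ) → ℝ} (hg : ∀ i, Continuous (g i))
    (h : ∀ x ∈ stdSimplex ℝ I, ∃ i, 0 ≤ g i x) :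
    ∃ x ∈ stdSimplex ℝ I, ∀ i, 0 ≤ g i x ∨ x i = 0 := by
  rcases Nat.lt_or_ge (Fintype.card I) 2 with hI | hI
  · have : Subsingleton I := Fintype.card_le_one_iff_subsingleton.1 (by omega)
    obtain ⟨i⟩ := ‹Nonempty I›
    obtain ⟨k, hk⟩ := h _ (single_mem_stdSimplex ℝ i)
    exact ⟨_, single_mem_stdSimplex ℝ i, fun j => Or.inl (Subsingleton.elim k j ▸ hk)⟩
  have hc : ∀ x : I → ℝ, ∃ i, x ∈ stdSimplex ℝ I → 0 ≤ g i x := fun x => by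
    by_cases hx : x ∈ stdSimplex ℝ I
    · exact (h x hx).imp fun _ h _ => h
    · exact ⟨Classical.arbitrary I, fun h => absurd h hx⟩
  choose c hc using hc
  choose x hx hxi using fun k : ℕ => exists_approx hI c (Nat.one_div_pos_of_nat (α := ℝ) (n := k))
  obtain ⟨z, hz, ψ, hψ, hlim⟩ := (isCompact_stdSimplex ℝ I).tendsto_subseq hx
  refine ⟨z, hz, fun i => ?_⟩
  -- Near `z` the function `g i` is negative, so label `i` is absent there, and coordinate `i` stays
  -- above the vanishing tolerance: neither alternative of `hxi` survives.
  by_contra! hcon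
  have hzi : 0 < z i := lt_of_le_of_ne (hz.1 i) hcon.2.symm
  have hnear : ∀ᶠ y in 𝓝 z, g i y < 0 := (hg i).continuousAt.eventually_lt_const hcon.1
  obtain ⟨δ, hδ, hball⟩ := Metric.eventually_nhds_iff.1 hnear
  have h1 : ∀ᶠ k in atTop, dist (x (ψ k)) z < min (δ / 2) (z i / 2) :=
    (tendsto_iff_dist_tendsto_zero.1 hlim).eventually_lt_const (by positivity)
  have h2 : ∀ᶠ k in atTop, (1 : ℝ) / ((ψ k : ℕ) + 1) < min (δ / 2) (z i / 2) :=
    (tendsto_one_div_add_atTop_nhds_zero_nat.comp hψ.tendsto_atTop).eventually_lt_const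
      (by positivity)
  obtain ⟨k, hk1, hk2⟩ := (h1.and h2).exists
  rw [lt_min_iff] at hk1 hk2
  rcases hxi (ψ k) i with ⟨y, hy, hyx, rfl⟩ | hsmall
  · refine absurd (hc y hy) (not_le.2 (hball ?_))
    calc dist y z ≤ dist y (x (ψ k)) + dist (x (ψ k)) z := dist_triangle _ _ _
      _ < δ := by linarith [hk1.1, hk2.1]
  · have h3 := (dist_le_pi_dist (x (ψ k)) z i).trans_lt hk1.2
    rw [Real.dist_eq] at h3
    linarith [abs_lt.1 h3, hk2.2]

/-- The **Knaster–Kuratowski–Mazurkiewicz lemma** on the standard simplex. -/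
theorem exists_mem_of_kkm [Nonempty I] {A : I → Set (I → ℝ)} (hA : ∀ i, IsClosed (A i))
    (h : ∀ x ∈ stdSimplex ℝ I, ∃ i, 0 < x i ∧ x ∈ A i) :
    ∃ x ∈ stdSimplex ℝ I, ∀ i, x ∈ A i := by
  have hne : ∀ i, (A i).Nonempty := fun i => by
    obtain ⟨k, hk, hkA⟩ := h _ (single_mem_stdSimplex ℝ i)
    have : k = i := by
      by_contra hki
      simp [Pi.single_eq_of_ne hki] at hk
    exact ⟨_, this ▸ hkA⟩
  let d : I → (I → ℝ) → ℝ := fun i x => Metric.infDist x (A i)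
  have hd : ∀ i, Continuous (d i) := fun i => Metric.continuous_infDist_pt _
  have hd0 : ∀ i x, 0 ≤ d i x := fun i x => Metric.infDist_nonneg
  let s : (I → ℝ) → ℝ := fun x => ∑ i, d i x
  have hs : Continuous s := continuous_finsetSum _ fun i _ => hd i
  have hsum : ∀ x ∈ stdSimplex ℝ I, ∑ i, (d i x - x i * s x) = 0 := fun x hx => by
    rw [Finset.sum_sub_distrib, ← Finset.sum_mul, hx.2, one_mul, sub_self]
  -- These functions add up to zero on the simplex. At the point found all are nonnegative, hence
  -- zero, so `d i x = x i * s x`; an index with `x i > 0` and `x ∈ A i` then forces `s x = 0`.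
  obtain ⟨x, hx, hxi⟩ := exists_complementary (g := fun i x => d i x - x i * s x)
    (fun i => (hd i).sub ((continuous_apply i).mul hs)) fun x hx => by
      by_contra! hneg
      have := Finset.sum_lt_sum_of_nonempty (Finset.univ_nonempty (α := I)) fun i _ => hneg i
      rw [hsum x hx] at this
      simp at this
  have hnn : ∀ i, 0 ≤ d i x - x i * s x := fun i => (hxi i).elim id fun h0 => by
    rw [h0]; simpa using hd0 i x
  have hzero := (Finset.sum_eq_zero_iff_of_nonneg fun i _ => hnn i).1 (hsum x hx)
  obtain ⟨i, hi, hiA⟩ := h x hx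
  have hs0 : s x = 0 := by
    have h1 := hzero i (Finset.mem_univ i)
    have h2 : d i x = 0 := Metric.infDist_zero_of_mem hiA
    rw [h2, zero_sub, neg_eq_zero] at h1
    exact (mul_eq_zero.1 h1).resolve_left hi.ne'
  refine ⟨x, hx, fun j => ((hA j).mem_iff_infDist_zero (hne j)).2 ?_⟩
  have := hzero j (Finset.mem_univ j)
  rw [hs0] at this
  simpa using this

end Simplex

end Scarf

namespace CoupledIneq

/-! ### Weak sequential compactness in reflexive spaces. -/

section Weak

variable {E : Type*} [NormedAddCommGroup E] [NormedSpace ℝ E]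

theorem continuous_weakSpace_eval (f : StrongDual ℝ E) :
    Continuous fun y : WeakSpace ℝ E => f ((toWeakSpace ℝ E).symm y) :=
  WeakBilin.eval_continuous (topDualPairing ℝ E).flip f

theorem weaklyTendsto_iff {x : ℕ → E} {a : E} :
    WeaklyTendsto x a ↔ ∀ f : StrongDual ℝ E, Tendsto (fun n => f (x n)) atTop (𝓝 (f a)) := by
  refine WeakBilin.tendsto_iff_forall_eval_tendsto (topDualPairing ℝ E).flip ?_
  intro x y h
  exact (NormedSpace.inclusionInDoubleDualLi (𝕜 := ℝ) (E := E)).injective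
    (ContinuousLinearMap.ext fun f => LinearMap.congr_fun h f)

theorem WeaklyTendsto.map {F : Type*} [NormedAddCommGroup F] [NormedSpace ℝ F] {x : ℕ → E} {a : E}
    (h : WeaklyTendsto x a) (T : E →L[ℝ] F) : WeaklyTendsto (fun n => T (x n)) (T a) :=
  weaklyTendsto_iff.2 fun f => weaklyTendsto_iff.1 h (f.comp T)

theorem weaklyTendsto_of_tendsto {x : ℕ → E} {a : E} (h : Tendsto x atTop (𝓝 a)) :
    WeaklyTendsto x a :=
  weaklyTendsto_iff.2 fun f => (f.continuous.tendsto a).comp h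

theorem WeaklyTendsto.comp_strictMono {x : ℕ → E} {a : E} (h : WeaklyTendsto x a) {ψ : ℕ → ℕ}
    (hψ : StrictMono ψ) : WeaklyTendsto (x ∘ ψ) a :=
  h.comp hψ.tendsto_atTop

/-- Uniform boundedness on the dual, which is complete even when `E` is not. -/
theorem WeaklyTendsto.exists_norm_le {x : ℕ → E} {a : E} (h : WeaklyTendsto x a) :
    ∃ C, ∀ n, ‖x n‖ ≤ C := by
  obtain ⟨C, hC⟩ := banach_steinhaus (g := fun n => NormedSpace.inclusionInDoubleDual ℝ E (x n))
    fun f => by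
      obtain ⟨C, hC⟩ := ((weaklyTendsto_iff.1 h f).norm).bddAbove_range
      exact ⟨C, fun n => hC ⟨n, rfl⟩⟩
  exact ⟨C, fun n => by
    rw [← (NormedSpace.inclusionInDoubleDualLi (𝕜 := ℝ) (E := E)).norm_map]; exact hC n⟩

/-- A compact operator turns weak convergence of sequences into norm convergence. -/
theorem WeaklyTendsto.map_compact {F : Type*} [NormedAddCommGroup F] [NormedSpace ℝ F]
    {x : ℕ → E} {a : E} (h : WeaklyTendsto x a) {T : E →L[ℝ] F} (hT : IsCompactOperator T) :
    Tendsto (fun n => T (x n)) atTop (𝓝 (T a)) := by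
  obtain ⟨C, hC⟩ := h.exists_norm_le
  obtain ⟨S, hS, hsub⟩ := hT.image_subset_compact_of_bounded
    (Metric.isBounded_closedBall (x := (0 : E)) (r := C))
  refine hS.tendsto_nhds_of_unique_mapClusterPt
    (Eventually.of_forall fun n => hsub ⟨x n, by simpa using hC n, rfl⟩) fun y _ hy => ?_
  obtain ⟨ψ, hψ, hlim⟩ := hy.tendsto_subseq
  refine (NormedSpace.inclusionInDoubleDualLi (𝕜 := ℝ) (E := F)).injective
    (ContinuousLinearMap.ext fun f => ?_)
  exact tendsto_nhds_unique ((f.continuous.tendsto y).comp hlim)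
    (weaklyTendsto_iff.1 ((h.map T).comp_strictMono hψ) f)

theorem Reflexive.isCompact_closure (hE : Reflexive E) {A : Set E} (hA : Bornology.IsBounded A) :
    IsCompact (closure (toWeakSpace ℝ E '' A)) := by
  refine NormedSpace.isCompact_closure_of_isBounded (𝕜 := ℝ) (X := E) _ ?_ fun y _ => ?_
  · rwa [Set.preimage_image_eq _ (toWeakSpace ℝ E).injective]
  · obtain ⟨x, hx⟩ := hE (WeakDual.toStrongDual y)
    exact ⟨toWeakSpace ℝ E x, hx⟩

theorem exists_mem_near_of_mem_closure {A : Set E} {a : E}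
    (ha : toWeakSpace ℝ E a ∈ closure (toWeakSpace ℝ E '' A)) (s : Finset (StrongDual ℝ E))
    {ε : ℝ} (hε : 0 < ε) : ∃ x ∈ A, ∀ f ∈ s, |f x - f a| < ε := by
  have hU : ∀ᶠ y in 𝓝 (toWeakSpace ℝ E a), ∀ f ∈ s,
      |f ((toWeakSpace ℝ E).symm y) - f a| < ε := by
    refine (Filter.eventually_all_finset s).2 fun f _ => ?_
    have : Continuous fun y : WeakSpace ℝ E => |f ((toWeakSpace ℝ E).symm y) - f a| :=
      ((continuous_weakSpace_eval f).sub continuous_const).abs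
    exact this.continuousAt.eventually_lt_const (by simpa using hε)
  obtain ⟨_, hy, x, hx, rfl⟩ := mem_closure_iff_nhds.1 ha _ hU
  exact ⟨x, hx, fun f hf => by simpa using hy f hf⟩

/-- A point in the weak closure of `A` is in the weak closure of a countable subset of `A`. -/
theorem exists_countable_near {A : Set E} {a : E}
    (ha : ∀ (s : Finset (StrongDual ℝ E)) (ε : ℝ), 0 < ε → ∃ x ∈ A, ∀ f ∈ s, |f x - f a| < ε) :
    ∃ D ⊆ A, D.Countable ∧
      ∀ (s : Finset (StrongDual ℝ E)) (ε : ℝ), 0 < ε → ∃ x ∈ D, ∀ f ∈ s, |f x - f a| < ε := by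
  -- The `k`-fold power of the dual unit ball is weak-* compact, and each point of `A` handles an
  -- open set of `k`-tuples; finitely many points suffice.
  have key : ∀ k m : ℕ, ∃ D : Set E, D ⊆ A ∧ D.Finite ∧ ∀ f : Fin k → StrongDual ℝ E,
      (∀ i, ‖f i‖ ≤ 1) → ∃ x ∈ D, ∀ i, |f i x - f i a| < 1 / ((m : ℝ) + 1) := by
    intro k m
    have hm : (0 : ℝ) < 1 / ((m : ℝ) + 1) := by positivity
    let P : Set (Fin k → WeakDual ℝ E) :=
      Set.univ.pi fun _ => WeakDual.toStrongDual ⁻¹' Metric.closedBall 0 1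
    have hP : IsCompact P := isCompact_univ_pi fun _ => WeakDual.isCompact_closedBall 0 1
    let O : A → Set (Fin k → WeakDual ℝ E) := fun x => {f | ∀ i, |f i x - f i a| < 1 / ((m : ℝ) + 1)}
    have hO : ∀ x, IsOpen (O x) := fun x => by
      have : O x = ⋂ i, {f | |f i x - f i a| < 1 / ((m : ℝ) + 1)} := by ext; simp [O]
      rw [this]
      refine isOpen_iInter_of_finite fun i => isOpen_lt ?_ continuous_const
      exact (((WeakDual.eval_continuous _).comp (continuous_apply i)).sub
        ((WeakDual.eval_continuous _).comp (continuous_apply i))).abs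
    have hcov : P ⊆ ⋃ x, O x := fun f _ => by
      classical
      obtain ⟨x, hx, h⟩ := ha (Finset.univ.image fun i => WeakDual.toStrongDual (f i)) _ hm
      exact Set.mem_iUnion.2 ⟨⟨x, hx⟩, fun i =>
        h _ (Finset.mem_image.2 ⟨i, Finset.mem_univ i, rfl⟩)⟩
    obtain ⟨t, ht⟩ := hP.elim_finite_subcover O hO hcov
    refine ⟨Subtype.val '' (t : Set A), by rintro _ ⟨x, -, rfl⟩; exact x.2,
      t.finite_toSet.image _, fun f hf => ?_⟩
    have hfP : (fun i => StrongDual.toWeakDual (f i)) ∈ P := fun i _ => by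
      simpa using hf i
    obtain ⟨x, hxt, hx⟩ := Set.mem_iUnion₂.1 (ht hfP)
    exact ⟨x, ⟨x, hxt, rfl⟩, hx⟩
  choose D hDA hDf hD using key
  refine ⟨⋃ k, ⋃ m, D k m, Set.iUnion_subset fun k => Set.iUnion_subset fun m => hDA k m,
    Set.countable_iUnion fun k => Set.countable_iUnion fun m => (hDf k m).countable,
    fun s ε hε => ?_⟩
  let M : ℝ := 1 + ∑ f ∈ s, ‖f‖
  have hM : 0 < M := by positivity
  have hfM : ∀ f ∈ s, ‖f‖ ≤ M := fun f hf => by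
    have := Finset.single_le_sum (f := fun f : StrongDual ℝ E => ‖f‖)
      (fun _ _ => norm_nonneg _) hf
    simp only [M]; linarith
  obtain ⟨m, hm⟩ := exists_nat_one_div_lt (div_pos hε hM)
  obtain ⟨x, hx, h⟩ := hD s.card m (fun i => M⁻¹ • (s.equivFin.symm i : StrongDual ℝ E)) fun i => by
    rw [norm_smul, norm_inv, Real.norm_of_nonneg hM.le, inv_mul_le_iff₀ hM, mul_one]
    exact hfM _ (s.equivFin.symm i).2
  refine ⟨x, Set.mem_iUnion₂.2 ⟨_, _, hx⟩, fun f hf => ?_⟩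
  have := h (s.equivFin ⟨f, hf⟩)
  simp only [Equiv.symm_apply_apply, smul_apply, smul_eq_mul] at this
  rw [← mul_sub, abs_mul, abs_of_pos (inv_pos.2 hM), inv_mul_lt_iff₀ hM] at this
  calc |f x - f a| < M * (1 / ((m : ℝ) + 1)) := this
    _ < M * (ε / M) := by gcongr
    _ = ε := by field_simp

/-- Countably many functionals separate the points of a closed separable subspace. -/
theorem exists_separating_seq {S : Set E} (hS : TopologicalSpace.IsSeparable S) :
    ∃ f : ℕ → StrongDual ℝ E, ∀ x ∈ S, (∀ n, f n x = 0) → x = 0 := by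
  obtain ⟨D, hDc, hD⟩ := hS
  rcases D.eq_empty_or_nonempty with rfl | hDne
  · exact ⟨0, fun x hx => by simpa using hD hx⟩
  obtain ⟨d, rfl⟩ := hDc.exists_eq_range hDne
  -- As `f n` norms `d n`, a vector killed by every `f n` is at distance at least `‖d n‖` from `d
  -- n`; for nonzero `x` this fails when `d n` is within `‖x‖ / 2` of `x`.
  choose f hf hfd using fun n => exists_dual_vector'' ℝ (d n)
  refine ⟨f, fun x hx h => ?_⟩
  by_contra hne
  have hpos : 0 < ‖x‖ / 2 := by positivity
  obtain ⟨_, ⟨n, rfl⟩, hn⟩ := Metric.mem_closure_iff.1 (hD hx) _ hpos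
  have h1 : ‖d n‖ ≤ dist x (d n) := by
    have h2 : f n (d n - x) = ‖d n‖ := by rw [map_sub, h n, sub_zero, hfd]; rfl
    calc ‖d n‖ = f n (d n - x) := h2.symm
      _ ≤ ‖f n (d n - x)‖ := Real.le_norm_self _
      _ ≤ 1 * ‖d n - x‖ := (f n).le_of_opNorm_le (hf n) _
      _ = dist x (d n) := by rw [one_mul, dist_comm, dist_eq_norm]
  have h3 : ‖x‖ ≤ dist x (d n) + ‖d n‖ := by
    rw [dist_eq_norm]
    calc ‖x‖ = ‖(x - d n) + d n‖ := by rw [sub_add_cancel]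
      _ ≤ _ := norm_add_le _ _
  linarith

/-- In a reflexive space, points of the weak closure of a bounded set are weak limits of
sequences. -/
theorem Reflexive.exists_seq_of_mem_closure (hE : Reflexive E) {A : Set E}
    (hA : Bornology.IsBounded A) {a : E}
    (ha : toWeakSpace ℝ E a ∈ closure (toWeakSpace ℝ E '' A)) :
    ∃ x : ℕ → E, (∀ n, x n ∈ A) ∧ WeaklyTendsto x a := by
  obtain ⟨D, hDA, hDc, hD⟩ := exists_countable_near fun s ε hε =>
    exists_mem_near_of_mem_closure ha s hε
  let S : Submodule ℝ E := (Submodule.span ℝ (insert a D)).topologicalClosure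
  have hSsep : TopologicalSpace.IsSeparable (S : Set E) :=
    (TopologicalSpace.IsSeparable.span (hDc.insert a).isSeparable).closure
  have hDS : ∀ x ∈ insert a D, x ∈ S := fun x hx =>
    Submodule.le_topologicalClosure _ (Submodule.subset_span hx)
  obtain ⟨f, hf⟩ := exists_separating_seq hSsep
  classical
  choose x hxD hx using fun n : ℕ =>
    hD ((Finset.range n).image f) (1 / ((n : ℝ) + 1)) (by positivity)
  -- By weak compactness it is enough that `a` is the only cluster point: any other would lie in the
  -- weakly closed `S` and agree with `a` on every separating `f j`.
  refine ⟨x, fun n => hDA (hxD n), (hE.isCompact_closure hA).tendsto_nhds_of_unique_mapClusterPt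
    (Eventually.of_forall fun n => subset_closure ⟨x n, hDA (hxD n), rfl⟩) fun y _ hy => ?_⟩
  obtain ⟨b, rfl⟩ := (toWeakSpace ℝ E).surjective y
  have hclosed : IsClosed (toWeakSpace ℝ E '' S) := by
    have h := S.convex.toWeakSpace_closure ℝ
    rw [(Submodule.isClosed_topologicalClosure _).closure_eq] at h
    rw [h]; exact isClosed_closure
  have hbS : b ∈ S := by
    have : toWeakSpace ℝ E b ∈ toWeakSpace ℝ E '' S :=
      hclosed.mem_of_mapClusterPt hy
        (Eventually.of_forall fun n => ⟨x n, hDS _ (Set.mem_insert_of_mem _ (hxD n)), rfl⟩)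
    obtain ⟨c, hc, h⟩ := this
    rwa [← (toWeakSpace ℝ E).injective h]
  have hfb : ∀ j, f j (b - a) = 0 := fun j => by
    have h1 : MapClusterPt (f j b) atTop (fun n => f j (x n)) :=
      MapClusterPt.continuousAt_comp (X := WeakSpace ℝ E)
        (continuous_weakSpace_eval (f j)).continuousAt hy
    have h2 : Tendsto (fun n => f j (x n)) atTop (𝓝 (f j a)) := by
      rw [tendsto_iff_dist_tendsto_zero]
      refine squeeze_zero' (Eventually.of_forall fun _ => dist_nonneg) ?_
        tendsto_one_div_add_atTop_nhds_zero_nat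
      filter_upwards [eventually_gt_atTop j] with n hn
      exact (hx n (f j) (Finset.mem_image.2 ⟨j, Finset.mem_range.2 hn, rfl⟩)).le
    obtain ⟨ψ, hψ, hlim⟩ := h1.tendsto_subseq
    rw [map_sub, sub_eq_zero]
    exact tendsto_nhds_unique hlim (h2.comp hψ.tendsto_atTop)
  have := hf (b - a) (S.sub_mem hbS (hDS _ (Set.mem_insert a D))) hfb
  rw [sub_eq_zero.1 this]

/-- In a reflexive space, bounded weakly sequentially closed sets with the finite intersection
property have a common point. -/
theorem Reflexive.exists_forall_mem (hE : Reflexive E) {ι : Type*} [Nonempty ι] {T : ι → Set E}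
    (hb : ∀ i, Bornology.IsBounded (T i))
    (hclosed : ∀ i (x : ℕ → E) (a : E), (∀ n, x n ∈ T i) → WeaklyTendsto x a → a ∈ T i)
    (hfin : ∀ u : Finset ι, u.Nonempty → ∃ a, ∀ i ∈ u, a ∈ T i) : ∃ a, ∀ i, a ∈ T i := by
  classical
  have hcl : ∀ i, IsClosed (toWeakSpace ℝ E '' T i) := fun i => by
    refine isClosed_of_closure_subset fun y hy => ?_
    obtain ⟨a, rfl⟩ := (toWeakSpace ℝ E).surjective y
    obtain ⟨x, hx, hlim⟩ := hE.exists_seq_of_mem_closure (hb i) hy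
    exact ⟨a, hclosed i x a hx hlim, rfl⟩
  obtain ⟨i₀⟩ := ‹Nonempty ι›
  have hcomp : IsCompact (toWeakSpace ℝ E '' T i₀) := by
    have := hE.isCompact_closure (hb i₀)
    rwa [(hcl i₀).closure_eq] at this
  obtain ⟨y, hy0, hy⟩ := hcomp.inter_iInter_nonempty _ hcl fun u => by
    obtain ⟨a, ha⟩ := hfin (insert i₀ u) (Finset.insert_nonempty _ _)
    exact ⟨toWeakSpace ℝ E a, ⟨a, ha _ (Finset.mem_insert_self _ _), rfl⟩,
      Set.mem_iInter₂.2 fun i hi => ⟨a, ha _ (Finset.mem_insert_of_mem hi), rfl⟩⟩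
  obtain ⟨a, -, rfl⟩ := hy0
  refine ⟨a, fun i => ?_⟩
  obtain ⟨b, hb, h⟩ := Set.mem_iInter.1 hy i
  rwa [← (toWeakSpace ℝ E).injective h]

/-- A closed convex set is weakly sequentially closed. -/
theorem mem_of_weaklyTendsto {A : Set E} (hA : IsClosed A) (hconv : Convex ℝ A) {x : ℕ → E} {a : E}
    (hx : ∀ᶠ n in atTop, x n ∈ A) (h : WeaklyTendsto x a) : a ∈ A := by
  have hcl := hconv.toWeakSpace_closure ℝ
  rw [hA.closure_eq] at hcl
  have : toWeakSpace ℝ E a ∈ toWeakSpace ℝ E '' A := by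
    rw [hcl]
    exact mem_closure_of_tendsto h (hx.mono fun n hn => Set.mem_image_of_mem _ hn)
  obtain ⟨b, hb, h⟩ := this
  rwa [← (toWeakSpace ℝ E).injective h]

/-- A functional on the dual of the product restricts to the duals of the two factors, and the
vectors representing the restrictions form the required pair. -/
theorem Reflexive.prod {F : Type*} [NormedAddCommGroup F] [NormedSpace ℝ F] (hE : Reflexive E)
    (hF : Reflexive F) : Reflexive (E × F) := by
  intro Φ
  obtain ⟨x, hx⟩ := hE (Φ.comp (ContinuousLinearMap.precomp ℝ (ContinuousLinearMap.fst ℝ E F)))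
  obtain ⟨y, hy⟩ := hF (Φ.comp (ContinuousLinearMap.precomp ℝ (ContinuousLinearMap.snd ℝ E F)))
  refine ⟨(x, y), ContinuousLinearMap.ext fun f => ?_⟩
  have h1 := DFunLike.congr_fun hx (f.comp (ContinuousLinearMap.inl ℝ E F))
  have h2 := DFunLike.congr_fun hy (f.comp (ContinuousLinearMap.inr ℝ E F))
  have h3 : f = (f.comp (ContinuousLinearMap.inl ℝ E F)).comp (ContinuousLinearMap.fst ℝ E F) +
      (f.comp (ContinuousLinearMap.inr ℝ E F)).comp (ContinuousLinearMap.snd ℝ E F) := by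
    ext p
    · simp [← Prod.zero_eq_mk]
    · simp [← Prod.zero_eq_mk]
  calc f (x, y) = f (x, 0) + f (0, y) := by rw [← map_add]; simp
    _ = Φ f := by
      conv_rhs => rw [h3, map_add]
      exact congrArg₂ (· + ·) h1 h2

end Weak

/-! ### Equilibrium points on bounded convex sets. -/

section Equilibrium

variable {E : Type*} [NormedAddCommGroup E] [NormedSpace ℝ E]

/-- An equilibrium theorem of Ky Fan type. The bifunction `Θ'` is a companion of `Θ` with better
semicontinuity, which agrees with `Θ` infinitesimally near the diagonal. -/
theorem Reflexive.exists_equilibrium (hE : Reflexive E) {M : Set E} (hMne : M.Nonempty)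
    (hMb : Bornology.IsBounded M) {ψ : E → ℝ} (hψ : ConvexOn ℝ M ψ)
    (hψcl : ∀ a, IsClosed {p ∈ M | ψ p ≤ a}) {Θ Θ' : E → E → ℝ}
    (hΘ : ∀ p, ConvexOn ℝ Set.univ (Θ p)) (hΘ0 : ∀ p, Θ p p = 0) (hle : ∀ p q, Θ p q ≤ Θ' p q)
    (husc : ∀ (q p : E) (x : ℕ → E), WeaklyTendsto x p → ∀ ε > 0,
      ∀ᶠ n in atTop, Θ' (x n) q ≤ Θ' p q + ε)
    (hlim : ∀ p q : E, ∀ ε > 0, ∀ᶠ t in 𝓝[>] (0 : ℝ), Θ' p (p + t • (q - p)) ≤ t * (Θ p q + ε)) :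
    ∃ p ∈ M, ∀ q ∈ M, ψ p ≤ Θ p q + ψ q := by
  let T : M → Set E := fun q => {p ∈ M | ψ p ≤ Θ' p q + ψ q}
  have hTclosed : ∀ q (x : ℕ → E) (a : E), (∀ n, x n ∈ T q) → WeaklyTendsto x a → a ∈ T q := by
    intro q x a hx hxa
    -- Sublevel sets of `ψ` are closed and convex, hence weakly sequentially closed.
    have key : ∀ ε > 0, a ∈ M ∧ ψ a ≤ Θ' a q + ψ q + ε := fun ε hε => by
      refine mem_of_weaklyTendsto (hψcl (Θ' a q + ψ q + ε)) (hψ.convex_le _) ?_ hxa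
      filter_upwards [husc q a x hxa ε hε] with n hn
      exact ⟨(hx n).1, by linarith [(hx n).2]⟩
    exact ⟨(key 1 one_pos).1, le_of_forall_pos_le_add fun ε hε => (key ε hε).2⟩
  have hfin : ∀ u : Finset M, u.Nonempty → ∃ a, ∀ i ∈ u, a ∈ T i := by
    intro u hu
    classical
    have : Nonempty u := hu.to_subtype
    let p : (u → ℝ) → E := fun w => ∑ i, w i • (i : E)
    have hp : Continuous p :=
      continuous_finsetSum _ fun i _ => (continuous_apply i).smul continuous_const
    obtain ⟨w, hw, h⟩ := Scarf.exists_mem_of_kkm (I := u)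
      (A := fun i => {w | w ∈ stdSimplex ℝ u ∧ p w ∈ T i}) (fun i => by
        refine IsSeqClosed.isClosed fun v w hv hvw => ⟨?_, ?_⟩
        · exact (isClosed_stdSimplex ℝ u).mem_of_tendsto hvw (Eventually.of_forall fun n => (hv n).1)
        · exact hTclosed i (fun n => p (v n)) _ (fun n => (hv n).2)
            (weaklyTendsto_of_tendsto ((hp.tendsto w).comp hvw)))
      (fun w hw => by
        have hpM : p w ∈ M := hψ.1.sum_mem (fun i _ => hw.1 i) hw.2 fun i _ => i.1.2
        by_contra! hcon
        -- Averaging these strict inequalities with weights `w` and using convexity and `Θ p p = 0`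
        -- would give `ψ (p w) < ψ (p w)`.
        have h1 : ∀ i, 0 < w i → Θ (p w) (i : E) + ψ i < ψ (p w) := fun i hi => by
          by_contra! hge
          exact hcon i hi ⟨hw, hpM, hge.trans (by gcongr; exact hle _ _)⟩
        have h2 : Θ (p w) (p w) + ψ (p w) ≤ ∑ i, w i • (Θ (p w) (i : E) + ψ i) :=
          (((hΘ (p w)).subset (Set.subset_univ M) hψ.1).add hψ).map_sum_le
            (fun i _ => hw.1 i) hw.2 fun i _ => i.1.2
        have h3 : ∑ i, w i • (Θ (p w) (i : E) + ψ i) < ∑ i, w i • ψ (p w) := by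
          obtain ⟨i, hi⟩ : ∃ i, 0 < w i := by
            by_contra! hnp
            have := Finset.sum_nonpos fun i (_ : i ∈ Finset.univ) => hnp i
            rw [hw.2] at this
            exact absurd this (by norm_num)
          refine Finset.sum_lt_sum (fun j _ => ?_)
            ⟨i, Finset.mem_univ i, mul_lt_mul_of_pos_left (h1 i hi) hi⟩
          rcases (hw.1 j).eq_or_lt with h0 | h0
          · simp [← h0]
          · exact (mul_lt_mul_of_pos_left (h1 j h0) h0).le
        rw [← Finset.sum_smul, hw.2, one_smul] at h3
        rw [hΘ0] at h2
        linarith)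
    exact ⟨p w, fun i hi => (h ⟨i, hi⟩).2⟩
  have : Nonempty M := hMne.to_subtype
  obtain ⟨p, hp⟩ := hE.exists_forall_mem (fun q => hMb.subset fun p hp => hp.1) hTclosed hfin
  have hpM : p ∈ M := (hp (Classical.arbitrary M)).1
  refine ⟨p, hpM, fun q hq => le_of_forall_pos_le_add fun ε hε => ?_⟩
  -- Minty's device: `p` is tested against a point of the segment towards `q`, where `Θ'` is at most
  -- `t * (Θ p q + ε)`; the factor `t` then cancels.
  obtain ⟨t, ht, ht0, ht1⟩ := ((hlim p q ε hε).and
    (Ioo_mem_nhdsGT (show (0 : ℝ) < 1 by norm_num))).exists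
  have hqt : p + t • (q - p) = (1 - t) • p + t • q := by module
  have h1 := (hp ⟨_, hψ.1 hpM hq (sub_nonneg.2 ht1.le) ht0.le (by ring)⟩).2
  have h2 := hψ.2 hpM hq (sub_nonneg.2 ht1.le) ht0.le (by ring)
  simp only at h1
  rw [hqt] at ht
  simp only [smul_eq_mul] at h2
  have h3 : t * ψ p ≤ t * (Θ p q + ψ q + ε) := by linarith
  exact le_of_mul_le_mul_left h3 ht0

end Equilibrium

/-! ### Calculus of Clarke's derivative. -/

section Clarke

variable {E : Type*} [NormedAddCommGroup E] [NormedSpace ℝ E] {h : E → ℝ} {α : ℝ≥0}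

theorem tendsto_shift (x y : E) :
    Tendsto (fun p : E × ℝ => p.1 + p.2 • y) (𝓝 x ×ˢ 𝓝[>] (0 : ℝ)) (𝓝 x) := by
  have h : Tendsto (fun p : E × ℝ => p.1 + p.2 • y) (𝓝 (x, 0)) (𝓝 (x + (0 : ℝ) • y)) :=
    (Continuous.tendsto (by fun_prop) _)
  rw [zero_smul, add_zero, nhds_prod_eq] at h
  exact h.mono_left (Filter.prod_mono le_rfl nhdsWithin_le_nhds)

omit [NormedSpace ℝ E] in
theorem eventually_snd_pos (x : E) : ∀ᶠ p : E × ℝ in 𝓝 x ×ˢ 𝓝[>] (0 : ℝ), 0 < p.2 :=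
  tendsto_snd.eventually self_mem_nhdsWithin

theorem eventually_abs_quotient_le (hh : ∀ x, ∃ U ∈ 𝓝 x, LipschitzOnWith α h U) (x y : E) :
    ∀ᶠ p : E × ℝ in 𝓝 x ×ˢ 𝓝[>] (0 : ℝ), |(h (p.1 + p.2 • y) - h p.1) / p.2| ≤ α * ‖y‖ := by
  obtain ⟨U, hU, hLip⟩ := hh x
  filter_upwards [(tendsto_shift x y).eventually hU, tendsto_fst.eventually hU,
    eventually_snd_pos x] with p h1 h2 h3
  have h4 := hLip.dist_le_mul _ h1 _ h2
  rw [Real.dist_eq, dist_eq_norm, add_sub_cancel_left, norm_smul, Real.norm_of_nonneg h3.le] at h4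
  rw [abs_div, abs_of_pos h3, div_le_iff₀ h3]
  linarith

/-- A real `limsup` obeys such a bound only for families that are not unbounded below; the Lipschitz
constant excludes that. -/
theorem clarkeDeriv_le (hh : ∀ x, ∃ U ∈ 𝓝 x, LipschitzOnWith α h U) {x y : E} {a : ℝ}
    (ha : ∀ᶠ p : E × ℝ in 𝓝 x ×ˢ 𝓝[>] (0 : ℝ), (h (p.1 + p.2 • y) - h p.1) / p.2 ≤ a) :
    clarkeDeriv h x y ≤ a := by
  refine limsup_le_of_le (IsBoundedUnder.isCoboundedUnder_le ⟨-(α * ‖y‖), ?_⟩) ha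
  exact eventually_map.2 ((eventually_abs_quotient_le hh x y).mono fun p hp => (abs_le.1 hp).1)

theorem eventually_lt_of_clarkeDeriv_lt (hh : ∀ x, ∃ U ∈ 𝓝 x, LipschitzOnWith α h U) {x y : E}
    {a : ℝ} (ha : clarkeDeriv h x y < a) :
    ∀ᶠ p : E × ℝ in 𝓝 x ×ˢ 𝓝[>] (0 : ℝ), (h (p.1 + p.2 • y) - h p.1) / p.2 < a :=
  eventually_lt_of_limsup_lt ha ⟨α * ‖y‖,
    eventually_map.2 ((eventually_abs_quotient_le hh x y).mono fun _ hp => (abs_le.1 hp).2)⟩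

theorem abs_clarkeDeriv_le (hh : ∀ x, ∃ U ∈ 𝓝 x, LipschitzOnWith α h U) (x y : E) :
    |clarkeDeriv h x y| ≤ α * ‖y‖ := by
  have hb := eventually_abs_quotient_le hh x y
  refine abs_le.2 ⟨?_, clarkeDeriv_le hh (hb.mono fun _ hp => (abs_le.1 hp).2)⟩
  by_contra! hlt
  obtain ⟨p, h1, h2⟩ := ((eventually_lt_of_clarkeDeriv_lt hh hlt).and hb).exists
  exact absurd (abs_le.1 h2).1 (not_le.2 h1)

theorem clarkeDeriv_zero (hh : ∀ x, ∃ U ∈ 𝓝 x, LipschitzOnWith α h U) (x : E) :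
    clarkeDeriv h x 0 = 0 := by
  simpa using abs_clarkeDeriv_le hh x 0

theorem clarkeDeriv_add_le (hh : ∀ x, ∃ U ∈ 𝓝 x, LipschitzOnWith α h U) (x y w : E) :
    clarkeDeriv h x (y + w) ≤ clarkeDeriv h x y + clarkeDeriv h x w := by
  refine le_of_forall_pos_le_add fun ε hε => clarkeDeriv_le hh ?_
  -- The increment along `y + w` splits at `z + t w`, which is again an allowed base point because
  -- it tends to `x`.
  have hshift : Tendsto (fun p : E × ℝ => (p.1 + p.2 • w, p.2)) (𝓝 x ×ˢ 𝓝[>] (0 : ℝ))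
      (𝓝 x ×ˢ 𝓝[>] (0 : ℝ)) := (tendsto_shift x w).prodMk tendsto_snd
  filter_upwards [hshift.eventually (eventually_lt_of_clarkeDeriv_lt hh
    (show clarkeDeriv h x y < clarkeDeriv h x y + ε / 2 by linarith)),
    eventually_lt_of_clarkeDeriv_lt hh
    (show clarkeDeriv h x w < clarkeDeriv h x w + ε / 2 by linarith)] with p h1 h2
  have h3 : p.1 + p.2 • (y + w) = p.1 + p.2 • w + p.2 • y := by module
  have h4 : (h (p.1 + p.2 • (y + w)) - h p.1) / p.2 =
      (h (p.1 + p.2 • w + p.2 • y) - h (p.1 + p.2 • w)) / p.2 +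
        (h (p.1 + p.2 • w) - h p.1) / p.2 := by
    rw [h3, ← add_div, sub_add_sub_cancel]
  rw [h4]; linarith

theorem clarkeDeriv_smul (hh : ∀ x, ∃ U ∈ 𝓝 x, LipschitzOnWith α h U) (x y : E) {s : ℝ}
    (hs : 0 < s) : clarkeDeriv h x (s • y) = s * clarkeDeriv h x y := by
  have key : ∀ (y : E) {s : ℝ}, 0 < s → clarkeDeriv h x (s • y) ≤ s * clarkeDeriv h x y := by
    intro y s hs
    refine le_of_forall_pos_le_add fun ε hε => clarkeDeriv_le hh ?_
    have hscale : Tendsto (fun p : E × ℝ => (p.1, s * p.2)) (𝓝 x ×ˢ 𝓝[>] (0 : ℝ))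
        (𝓝 x ×ˢ 𝓝[>] (0 : ℝ)) := by
      refine tendsto_fst.prodMk (tendsto_nhdsWithin_iff.2 ⟨?_, ?_⟩)
      · have : Tendsto (fun t : ℝ => s * t) (𝓝[>] 0) (𝓝 (s * 0)) :=
          (tendsto_id.mono_left nhdsWithin_le_nhds).const_mul s
        rw [mul_zero] at this
        exact this.comp tendsto_snd
      · exact (eventually_snd_pos x).mono fun p hp => mul_pos hs hp
    filter_upwards [hscale.eventually (eventually_lt_of_clarkeDeriv_lt hh
      (show clarkeDeriv h x y < clarkeDeriv h x y + ε / s by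
        linarith [div_pos hε hs])), eventually_snd_pos x] with p h1 h2
    have h3 : p.1 + p.2 • s • y = p.1 + (s * p.2) • y := by module
    have h4 : (h (p.1 + p.2 • s • y) - h p.1) / p.2 =
        s * ((h (p.1 + (s * p.2) • y) - h p.1) / (s * p.2)) := by
      rw [h3]; field_simp
    have h5 := mul_lt_mul_of_pos_left h1 hs
    rw [mul_add, mul_div_cancel₀ _ hs.ne'] at h5
    rw [h4]
    exact h5.le
  refine le_antisymm (key y hs) ?_
  have h1 := key (s • y) (inv_pos.2 hs)
  rw [smul_smul, inv_mul_cancel₀ hs.ne', one_smul, inv_mul_eq_div, le_div_iff₀ hs] at h1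
  linarith

theorem clarkeDeriv_smul_of_nonneg (hh : ∀ x, ∃ U ∈ 𝓝 x, LipschitzOnWith α h U) (x y : E) {s : ℝ}
    (hs : 0 ≤ s) : clarkeDeriv h x (s • y) = s * clarkeDeriv h x y := by
  rcases hs.eq_or_lt with rfl | hs
  · rw [zero_smul, zero_mul, clarkeDeriv_zero hh]
  · exact clarkeDeriv_smul hh x y hs

theorem neg_clarkeDeriv_neg_le (hh : ∀ x, ∃ U ∈ 𝓝 x, LipschitzOnWith α h U) (x y : E) :
    -clarkeDeriv h x (-y) ≤ clarkeDeriv h x y := by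
  have := clarkeDeriv_add_le hh x y (-y)
  rw [add_neg_cancel, clarkeDeriv_zero hh] at this
  linarith

theorem clarkeDeriv_le_add (hh : ∀ x, ∃ U ∈ 𝓝 x, LipschitzOnWith α h U) (x y w : E) :
    clarkeDeriv h x y ≤ clarkeDeriv h x w + α * ‖y - w‖ := by
  have h1 := clarkeDeriv_add_le hh x w (y - w)
  rw [add_sub_cancel] at h1
  linarith [(abs_le.1 (abs_clarkeDeriv_le hh x (y - w))).2]

theorem continuous_clarkeDeriv (hh : ∀ x, ∃ U ∈ 𝓝 x, LipschitzOnWith α h U) (x : E) :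
    Continuous (clarkeDeriv h x) :=
  (LipschitzWith.of_le_add_mul α fun y w => by
    rw [dist_eq_norm]; exact clarkeDeriv_le_add hh x y w).continuous

/-- Upper semicontinuity of Clarke's derivative in both variables. -/
theorem eventually_clarkeDeriv_lt (hh : ∀ x, ∃ U ∈ 𝓝 x, LipschitzOnWith α h U) {ι : Type*}
    {l : Filter ι} {u w : ι → E} {x y : E} (hu : Tendsto u l (𝓝 x)) (hw : Tendsto w l (𝓝 y))
    {a : ℝ} (ha : clarkeDeriv h x y < a) : ∀ᶠ n in l, clarkeDeriv h (u n) (w n) < a := by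
  obtain ⟨b, hb, hba⟩ := exists_between ha
  have h1 : ∀ᶠ z in 𝓝 x, clarkeDeriv h z y ≤ b := by
    obtain ⟨p, hp, q, hq, hpq⟩ := eventually_prod_iff.1 (eventually_lt_of_clarkeDeriv_lt hh hb)
    filter_upwards [eventually_eventually_nhds.2 hp] with z hz
    exact clarkeDeriv_le hh (eventually_prod_iff.2 ⟨p, hz, q, hq, fun h1 _ h2 => (hpq h1 h2).le⟩)
  have h2 : Tendsto (fun n => α * ‖w n - y‖) l (𝓝 (α * 0)) :=
    (tendsto_iff_norm_sub_tendsto_zero.1 hw).const_mul _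
  rw [mul_zero] at h2
  filter_upwards [hu.eventually h1, h2.eventually_lt_const (sub_pos.2 hba)] with n h3 h4
  linarith [clarkeDeriv_le_add hh (u n) (w n) y]

/-- Hahn–Banach: the prescribed value on the line through `d` extends below the sublinear Clarke
derivative, whose Lipschitz bound makes the extension continuous. -/
theorem exists_mem_clarkeSubdiff (hh : ∀ x, ∃ U ∈ 𝓝 x, LipschitzOnWith α h U) (x d : E) :
    ∃ ξ ∈ clarkeSubdiff h x, ξ d = clarkeDeriv h x d := by
  obtain ⟨f, hfd, hf⟩ : ∃ f : E →ₗ.[ℝ] ℝ, (∃ hd : d ∈ f.domain, f ⟨d, hd⟩ = clarkeDeriv h x d) ∧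
      ∀ v : f.domain, f v ≤ clarkeDeriv h x v := by
    have hker : ∀ c : ℝ, c • d = 0 → c • clarkeDeriv h x d = 0 := fun c hc => by
      rcases smul_eq_zero.1 hc with rfl | rfl
      · simp
      · rw [clarkeDeriv_zero hh, smul_zero]
    refine ⟨LinearPMap.mkSpanSingleton' d (clarkeDeriv h x d) hker,
      ⟨Submodule.mem_span_singleton_self d, LinearPMap.mkSpanSingleton'_apply_self _ _ _ _⟩, ?_⟩
    rintro ⟨v, hv⟩
    obtain ⟨c, rfl⟩ := Submodule.mem_span_singleton.1 hv
    rw [LinearPMap.mkSpanSingleton'_apply, smul_eq_mul]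
    rcases le_or_gt 0 c with hc | hc
    · exact (clarkeDeriv_smul_of_nonneg hh x d hc).ge
    · have h1 := clarkeDeriv_smul hh x d (neg_pos.2 hc)
      have h2 := neg_clarkeDeriv_neg_le hh x (c • d)
      rw [← neg_smul, h1] at h2
      simp only [RingHom.id_apply]
      linarith
  obtain ⟨g, hg, hgle⟩ := exists_extension_of_le_sublinear f (clarkeDeriv h x)
    (fun c hc y => clarkeDeriv_smul hh x y hc) (clarkeDeriv_add_le hh x) hf
  refine ⟨g.mkContinuous α fun y => abs_le.2 ⟨?_, ?_⟩, hgle, ?_⟩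
  · have := (hgle (-y)).trans (abs_le.1 (abs_clarkeDeriv_le hh x (-y))).2
    rw [map_neg, norm_neg] at this
    linarith
  · exact (hgle y).trans (abs_le.1 (abs_clarkeDeriv_le hh x y)).2
  · obtain ⟨hd, hfd⟩ := hfd
    exact (hg ⟨d, hd⟩).trans hfd

omit [NormedSpace ℝ E] in
theorem BoundedLocalLipschitz.exists_const (hh : BoundedLocalLipschitz h) :
    ∃ α : ℝ≥0, ∀ x, ∃ U ∈ 𝓝 x, LipschitzOnWith α h U := by
  obtain ⟨c, α, -, hc, hα⟩ := hh
  exact ⟨α, fun x => (hc x).imp fun U hU => ⟨hU.1, hU.2.weaken (hα x)⟩⟩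

end Clarke

/-! ### Companions from the three operator conditions. -/

section Operators

variable {E Z : Type*} [NormedAddCommGroup E] [NormedSpace ℝ E]
  [NormedAddCommGroup Z] [NormedSpace ℝ Z]

/-- A concave `β` with `β 0 ≤ 0` cannot weaken dissipativity. -/
theorem ConcaveRelaxedDissipative.apply_nonpos {A : E → Set (StrongDual ℝ E)}
    (hA : ConcaveRelaxedDissipative A) {x y : E} {ζx ζy : StrongDual ℝ E} (hx : ζx ∈ A x)
    (hy : ζy ∈ A y) : (ζy - ζx) (y - x) ≤ 0 := by
  obtain ⟨β, hβ, hβ0, h⟩ := hA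
  have h1 := h x y ζx hx ζy hy
  have h2 := h y x ζy hy ζx hx
  -- The pairing is unchanged when `x` and `y` are exchanged, so it is at most the mean of `β (y -
  -- x)` and `β (x - y)`, which concavity bounds by `β 0`.
  have h3 := hβ.2 (Set.mem_univ (y - x)) (Set.mem_univ (x - y))
    (show (0 : ℝ) ≤ 1 / 2 by norm_num) (show (0 : ℝ) ≤ 1 / 2 by norm_num) (by norm_num)
  have h4 : (1 / 2 : ℝ) • (y - x) + (1 / 2 : ℝ) • (x - y) = 0 := by module
  have h5 : (ζx - ζy) (x - y) = (ζy - ζx) (y - x) := by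
    rw [← neg_sub ζy, ← neg_sub y, map_neg]; simp
  rw [h4] at h3
  simp only [smul_eq_mul] at h3
  linarith

theorem eventually_mul_clarkeDeriv_le {h : Z → ℝ} {α : ℝ≥0}
    (hh : ∀ x, ∃ U ∈ 𝓝 x, LipschitzOnWith α h U) {ι : Type*} {l : Filter ι} {u w : ι → Z}
    {k : ι → ℝ} {x y : Z} {c : ℝ} (hk : Tendsto k l (𝓝 c)) (hk0 : ∀ n, 0 < k n) (hc : 0 < c)
    (hu : Tendsto u l (𝓝 x)) (hw : Tendsto w l (𝓝 y)) {ε : ℝ} (hε : 0 < ε) :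
    ∀ᶠ n in l, k n * clarkeDeriv h (u n) (w n) ≤ c * clarkeDeriv h x y + ε := by
  have hlt : clarkeDeriv h x y < clarkeDeriv h x y + ε / (2 * c) := by
    linarith [show 0 < ε / (2 * c) by positivity]
  have h1 : c * (clarkeDeriv h x y + ε / (2 * c)) = c * clarkeDeriv h x y + ε / 2 := by
    field_simp
  have h2 : ∀ᶠ n in l, k n * (clarkeDeriv h x y + ε / (2 * c)) < c * clarkeDeriv h x y + ε :=
    (hk.mul_const _).eventually_lt_const (by rw [h1]; linarith)
  filter_upwards [h2, eventually_clarkeDeriv_lt hh hu hw hlt] with n h3 h4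
  exact (mul_le_mul_of_nonneg_left h4.le (hk0 n).le).trans h3.le

theorem tendsto_add_smul (u d : E) :
    Tendsto (fun t : ℝ => u + t • d) (𝓝[>] 0) (𝓝 u) := by
  have : Tendsto (fun t : ℝ => u + t • d) (𝓝 0) (𝓝 (u + (0 : ℝ) • d)) :=
    Continuous.tendsto (by fun_prop) _
  rw [zero_smul, add_zero] at this
  exact this.mono_left nhdsWithin_le_nhds

/-- The bifunction of a hemivariational inequality with operator `A` and potential `h`. -/
noncomputable def bifun (A : E → StrongDual ℝ E) (c : E → ℝ) (γ : E →L[ℝ] Z) (h : Z → ℝ) (u v : E) : ℝ :=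
  -A u (v - u) + c u * clarkeDeriv h (γ u) (γ (v - u))

section Bifun

variable {A : E → StrongDual ℝ E} {c : E → ℝ} {γ : E →L[ℝ] Z} {h : Z → ℝ} {α : ℝ≥0}
  (hh : ∀ x, ∃ U ∈ 𝓝 x, LipschitzOnWith α h U)
include hh

theorem bifun_self (u : E) : bifun A c γ h u u = 0 := by
  simp [bifun, clarkeDeriv_zero hh]

theorem bifun_add_smul (u d : E) {t : ℝ} (ht : 0 ≤ t) :
    bifun A c γ h u (u + t • d) = t * bifun A c γ h u (u + d) := by
  simp only [bifun, add_sub_cancel_left, map_smul, smul_eq_mul]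
  rw [clarkeDeriv_smul_of_nonneg hh _ _ ht]; ring

theorem convexOn_bifun (hc : ∀ u, 0 < c u) (u : E) :
    ConvexOn ℝ Set.univ (bifun A c γ h u) := by
  refine ⟨convex_univ, fun x _ y _ a b ha hb hab => ?_⟩
  have h1 : a • x + b • y - u = a • (x - u) + b • (y - u) := by
    rw [← eq_sub_iff_add_eq'] at hab
    rw [hab]; module
  simp only [bifun, h1, map_add, map_smul, smul_eq_mul]
  have h2 := clarkeDeriv_add_le hh (γ u) (a • γ (x - u)) (b • γ (y - u))
  rw [clarkeDeriv_smul_of_nonneg hh _ _ ha, clarkeDeriv_smul_of_nonneg hh _ _ hb] at h2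
  have h3 := mul_le_mul_of_nonneg_left h2 (hc u).le
  linarith

end Bifun

/-- The bifunction has a majorant which is weakly sequentially upper semicontinuous in its first
variable and has the same slope on the diagonal. -/
def HasCompanion (f : E → E → ℝ) : Prop :=
  ∃ f' : E → E → ℝ, (∀ u v, f u v ≤ f' u v) ∧
    (∀ (v u : E) (x : ℕ → E), WeaklyTendsto x u → ∀ ε > 0,
      ∀ᶠ n in atTop, f' (x n) v ≤ f' u v + ε) ∧
    ∀ u v : E, ∀ ε > 0, ∀ᶠ t in 𝓝[>] (0 : ℝ), f' u (u + t • (v - u)) ≤ t * (f u v + ε)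

section Companion

variable {A : E → StrongDual ℝ E} {c : E → ℝ} {γ : E →L[ℝ] Z} {h : Z → ℝ} {α : ℝ≥0}
  (hh : ∀ x, ∃ U ∈ 𝓝 x, LipschitzOnWith α h U) (hγ : IsCompactOperator γ) (hc0 : ∀ u, 0 < c u)
  (hc : ∀ (σ : E) (s : ℕ → E), WeaklyTendsto s σ → Tendsto (fun n => c (s n)) atTop (𝓝 (c σ)))
include hh hγ hc0 hc

theorem eventually_clarke_term_le {x : ℕ → E} {u : E} (hx : WeaklyTendsto x u) (v : E) {ε : ℝ}
    (hε : 0 < ε) : ∀ᶠ n in atTop, c (x n) * clarkeDeriv h (γ (x n)) (γ (v - x n)) ≤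
      c u * clarkeDeriv h (γ u) (γ (v - u)) + ε := by
  have hγx := hx.map_compact hγ
  refine eventually_mul_clarkeDeriv_le hh (hc u x hx) (fun n => hc0 _) (hc0 u) hγx ?_ hε
  simp only [map_sub]
  exact tendsto_const_nhds.sub hγx

theorem OpCond1.hasCompanion (hA : OpCond1 A) : HasCompanion (bifun A c γ h) := by
  refine ⟨bifun A c γ h, fun _ _ => le_rfl, fun v u x hx ε hε => ?_, fun u v ε hε => ?_⟩
  · have h1 : ((A u (v - u) - ε / 2 : ℝ) : EReal) <
        liminf (fun n => ((A (x n) (v - x n) : ℝ) : EReal)) atTop :=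
      lt_of_lt_of_le (EReal.coe_lt_coe_iff.2 (by linarith)) (hA v u x hx)
    filter_upwards [eventually_lt_of_lt_liminf h1,
      eventually_clarke_term_le hh hγ hc0 hc hx v (half_pos hε)] with n h2 h3
    have h4 := EReal.coe_lt_coe_iff.1 h2
    simp only [bifun]
    linarith
  · filter_upwards [self_mem_nhdsWithin] with t ht
    rw [bifun_add_smul hh _ _ (le_of_lt ht), add_sub_cancel]
    exact mul_le_mul_of_nonneg_left (by linarith) (le_of_lt ht)

theorem OpCond2.hasCompanion (hA : OpCond2 A) : HasCompanion (bifun A c γ h) := by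
  obtain ⟨hhemi, hdiss⟩ := hA
  -- Evaluating `A` at `v` makes the operator term affine and weakly continuous in `u`;
  -- dissipativity makes it a majorant.
  refine ⟨fun u v => -A v (v - u) + c u * clarkeDeriv h (γ u) (γ (v - u)), fun u v => ?_,
    fun v u x hx ε hε => ?_, fun u v ε hε => ?_⟩
  · have := hdiss.apply_nonpos (x := u) (y := v) rfl rfl
    rw [sub_apply] at this
    simp only [bifun]
    linarith
  · have h1 : Tendsto (fun n => -A v (v - x n)) atTop (𝓝 (-A v (v - u))) := by
      simp only [map_sub]
      exact (tendsto_const_nhds.sub (weaklyTendsto_iff.1 hx (A v))).neg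
    filter_upwards [h1.eventually_lt_const (show _ < -A v (v - u) + ε / 2 by linarith),
      eventually_clarke_term_le hh hγ hc0 hc hx v (half_pos hε)] with n h2 h3
    linarith
  · filter_upwards [(hhemi u v (v - u)).eventually_const_lt
      (show A u (v - u) - ε < _ by linarith), self_mem_nhdsWithin] with t h1 ht
    simp only [bifun, add_sub_cancel_left, map_smul, smul_eq_mul]
    rw [clarkeDeriv_smul hh _ _ ht]
    have h2 := mul_lt_mul_of_pos_left h1 ht
    linarith

theorem OpCond3.hasCompanion (hA : OpCond3 A c γ h) : HasCompanion (bifun A c γ h) := by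
  obtain ⟨hhemi, hdiss⟩ := hA
  -- Here the Clarke term moves to `v` as well. Subgradients attaining the derivatives at `γ u` and
  -- `γ v` turn dissipativity of the combined operator into the majorization.
  refine ⟨fun u v => -A v (v - u) - c v * clarkeDeriv h (γ v) (γ (u - v)), fun u v => ?_,
    fun v u x hx ε hε => ?_, fun u v ε hε => ?_⟩
  · obtain ⟨ξ, hξ, hξd⟩ := exists_mem_clarkeSubdiff hh (γ u) (γ (v - u))
    obtain ⟨η, hη, hηd⟩ := exists_mem_clarkeSubdiff hh (γ v) (γ (u - v))
    have h1 := hdiss.apply_nonpos (x := u) (y := v) ⟨ξ, hξ, rfl⟩ ⟨η, hη, rfl⟩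
    have h2 : η (γ (v - u)) = -clarkeDeriv h (γ v) (γ (u - v)) := by
      rw [← hηd, ← neg_sub u v, map_neg, map_neg]
    simp only [sub_apply, smul_apply, ContinuousLinearMap.comp_apply,
      smul_eq_mul, h2, hξd] at h1
    simp only [bifun]
    linarith
  · have hγx := hx.map_compact hγ
    have h1 : Tendsto (fun n => -A v (v - x n) - c v * clarkeDeriv h (γ v) (γ (x n - v))) atTop
        (𝓝 (-A v (v - u) - c v * clarkeDeriv h (γ v) (γ (u - v)))) := by
      simp only [map_sub]
      exact (tendsto_const_nhds.sub (weaklyTendsto_iff.1 hx (A v))).neg.sub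
        ((((continuous_clarkeDeriv hh (γ v)).tendsto _).comp
          (hγx.sub tendsto_const_nhds)).const_mul _)
    filter_upwards [h1.eventually_lt_const (lt_add_of_pos_right _ hε)] with n hn
    exact hn.le
  · have hcseg : Tendsto (fun t : ℝ => c (u + t • (v - u))) (𝓝[>] 0) (𝓝 (c u)) :=
      tendsto_of_seq_tendsto fun t ht =>
        hc u _ (weaklyTendsto_of_tendsto ((tendsto_add_smul u (v - u)).comp ht))
    filter_upwards [(hhemi u v (v - u)).eventually_const_lt
      (show A u (v - u) - ε / 2 < _ by linarith),
      eventually_mul_clarkeDeriv_le hh hcseg (fun t => hc0 _) (hc0 u)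
        ((γ.continuous.tendsto u).comp (tendsto_add_smul u (v - u)))
        (tendsto_const_nhds (x := γ (v - u))) (half_pos hε), self_mem_nhdsWithin] with t h1 h2 ht
    have h3 : u - (u + t • (v - u)) = t • (-(v - u)) := by module
    simp only [bifun, add_sub_cancel_left, h3]
    rw [map_smul, map_smul, clarkeDeriv_smul hh _ _ ht, map_neg, smul_eq_mul]
    simp only [Function.comp_apply] at h2
    have h4 := mul_le_mul_of_nonneg_left
      (neg_clarkeDeriv_neg_le hh (γ (u + t • (v - u))) (γ (v - u))) (hc0 (u + t • (v - u))).le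
    have h5 : -A (u + t • (v - u)) (v - u) -
        c (u + t • (v - u)) * clarkeDeriv h (γ (u + t • (v - u))) (-γ (v - u)) ≤
        -A u (v - u) + c u * clarkeDeriv h (γ u) (γ (v - u)) + ε := by linarith
    have h6 := mul_le_mul_of_nonneg_left h5 (le_of_lt ht)
    linarith

end Companion

end Operators

/-! ### Convex functionals with values in `(-∞, ∞]`. -/

section EffDomain

variable {E : Type*} [NormedAddCommGroup E] [NormedSpace ℝ E] {φ : E → EReal}

omit [NormedAddCommGroup E] [NormedSpace ℝ E] in
theorem coe_toReal_of_mem (hbot : ∀ x, φ x ≠ ⊥) {x : E} (hx : x ∈ effDomain φ) :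
    ((φ x).toReal : EReal) = φ x :=
  EReal.coe_toReal (ne_of_lt hx) (hbot x)

theorem convexOn_toReal (hbot : ∀ x, φ x ≠ ⊥) (hφ : ERealConvex φ) :
    ConvexOn ℝ (effDomain φ) fun x => (φ x).toReal := by
  have key : ∀ x ∈ effDomain φ, ∀ y ∈ effDomain φ, ∀ a b : ℝ, 0 ≤ a → 0 ≤ b → a + b = 1 →
      φ (a • x + b • y) ≤ ((a * (φ x).toReal + b * (φ y).toReal : ℝ) : EReal) := by
    intro x hx y hy a b ha hb hab
    obtain rfl : b = 1 - a := by linarith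
    have := hφ x y a ha (by linarith)
    rw [← coe_toReal_of_mem hbot hx, ← coe_toReal_of_mem hbot hy] at this
    exact_mod_cast this
  have hdom : Convex ℝ (effDomain φ) := fun x hx y hy a b ha hb hab =>
    (key x hx y hy a b ha hb hab).trans_lt (EReal.coe_lt_top _)
  refine ⟨hdom, fun x hx y hy a b ha hb hab => ?_⟩
  have := key x hx y hy a b ha hb hab
  rw [← coe_toReal_of_mem hbot (hdom hx hy ha hb hab)] at this
  exact EReal.coe_le_coe_iff.1 this

/-- A convex lower semicontinuous functional decreases at most linearly. -/
theorem exists_linear_lower_bound (hbot : ∀ x, φ x ≠ ⊥) (hφ : ERealConvex φ)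
    (hlsc : LowerSemicontinuous φ) {x₀ : E} (hx₀ : x₀ ∈ effDomain φ) :
    ∃ k ≥ 0, ∀ x ∈ effDomain φ, (φ x₀).toReal - 1 - k * ‖x - x₀‖ ≤ (φ x).toReal := by
  have hconv := convexOn_toReal hbot hφ
  have h1 : (((φ x₀).toReal - 1 : ℝ) : EReal) < φ x₀ := by
    conv_rhs => rw [← coe_toReal_of_mem hbot hx₀]
    exact EReal.coe_lt_coe_iff.2 (by linarith)
  obtain ⟨δ, hδ, hball⟩ := Metric.eventually_nhds_iff.1 (hlsc x₀ _ h1)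
  have hball' : ∀ y ∈ effDomain φ, dist y x₀ < δ → (φ x₀).toReal - 1 < (φ y).toReal := by
    intro y hy hyδ
    have : (((φ x₀).toReal - 1 : ℝ) : EReal) < φ y := hball hyδ
    rw [← coe_toReal_of_mem hbot hy] at this
    exact EReal.coe_lt_coe_iff.1 this
  refine ⟨2 / δ, by positivity, fun x hx => ?_⟩
  rcases lt_or_ge (dist x x₀) δ with hlt | hge
  · have : 0 ≤ 2 / δ * ‖x - x₀‖ := by positivity
    linarith [hball' x hx hlt]
  · rw [dist_eq_norm] at hge
    have hpos : 0 < ‖x - x₀‖ := hδ.trans_le hge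
    -- This `t` places the convex combination at distance `δ / 2` from `x₀`, where `φ` is still
    -- above `φ x₀ - 1`; convexity then costs `1 / t`, which is linear in the distance.
    obtain ⟨t, ht⟩ : ∃ t, t = δ / (2 * ‖x - x₀‖) := ⟨_, rfl⟩
    have ht0 : 0 < t := by rw [ht]; positivity
    have ht1 : t ≤ 1 := by rw [ht, div_le_one (by positivity)]; linarith
    have htn : t * ‖x - x₀‖ = δ / 2 := by rw [ht]; field_simp
    have h2 := hball' ((1 - t) • x₀ + t • x) (hconv.1 hx₀ hx (by linarith) ht0.le (by ring)) (by
      have : (1 - t) • x₀ + t • x - x₀ = t • (x - x₀) := by module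
      rw [dist_eq_norm, this, norm_smul, Real.norm_of_nonneg ht0.le, htn]
      linarith)
    have h3 := hconv.2 hx₀ hx (sub_nonneg.2 ht1) ht0.le (by ring)
    simp only [smul_eq_mul] at h3
    have h4 : t * ((φ x₀).toReal - 2 / δ * ‖x - x₀‖) < t * (φ x).toReal := by
      have : t * (2 / δ * ‖x - x₀‖) = 1 := by
        rw [mul_left_comm, htn]; field_simp
      rw [mul_sub, this]
      linarith
    linarith [lt_of_mul_lt_mul_left h4 ht0.le]

end EffDomain

/-! ### Solving the coupled system. -/

section Main

variable {X Y : Type*} [NormedAddCommGroup X] [NormedSpace ℝ X]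
  [NormedAddCommGroup Y] [NormedSpace ℝ Y]

/-- The sum of `B` and `φ`, as a real function. -/
noncomputable def energy (B : X × Y → ℝ) (φ : X → EReal) (p : X × Y) : ℝ := B p + (φ p.1).toReal

/-- Admissible pairs at which `φ` is finite. -/
def admissible (K : Set X) (Λ : Set Y) (φ : X → EReal) : Set (X × Y) :=
  {p | p.1 ∈ K ∧ p.1 ∈ effDomain φ ∧ p.2 ∈ Λ}

variable {K : Set X} {Λ : Set Y} {B : X × Y → ℝ} {φ : X → EReal}

theorem convexOn_energy (hKconv : Convex ℝ K) (hΛconv : Convex ℝ Λ) (hbot : ∀ x, φ x ≠ ⊥)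
    (hφ : ERealConvex φ) (hB : ConvexOn ℝ Set.univ B) :
    ConvexOn ℝ (admissible K Λ φ) (energy B φ) := by
  have h1 := (convexOn_toReal hbot hφ).comp_linearMap (LinearMap.fst ℝ X Y)
  have hconv : Convex ℝ (admissible K Λ φ) :=
    (hKconv.linear_preimage (LinearMap.fst ℝ X Y)).inter
      (h1.1.inter (hΛconv.linear_preimage (LinearMap.snd ℝ X Y)))
  exact (hB.subset (Set.subset_univ _) hconv).add (h1.subset (fun p hp => hp.2.1) hconv)

omit [NormedSpace ℝ X] [NormedSpace ℝ Y] in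
-- `toReal` sends `⊤` to `0`, so `energy` alone is unsuitable; the extended sum `B + φ` is lower
-- semicontinuous, and its real sublevels force `φ` to be finite.
theorem isClosed_sublevel_energy (hKcl : IsClosed K) (hΛcl : IsClosed Λ) (hbot : ∀ x, φ x ≠ ⊥)
    (hlsc : LowerSemicontinuous φ) (hB : LowerSemicontinuous B) (a : ℝ) :
    IsClosed {p ∈ admissible K Λ φ | energy B φ p ≤ a} := by
  have hsum : LowerSemicontinuous fun p : X × Y => (B p : EReal) + φ p.1 := by
    refine LowerSemicontinuous.add'
      (continuous_coe_real_ereal.comp_lowerSemicontinuous hB EReal.coe_strictMono.monotone)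
      (hlsc.comp continuous_fst) fun p => ?_
    exact EReal.continuousAt_add (Or.inr (hbot _)) (Or.inl (EReal.coe_ne_bot _))
  have heq : {p ∈ admissible K Λ φ | energy B φ p ≤ a} =
      (Prod.fst ⁻¹' K ∩ Prod.snd ⁻¹' Λ) ∩ {p | (B p : EReal) + φ p.1 ≤ a} := by
    ext p
    have key : p.1 ∈ effDomain φ ∧ energy B φ p ≤ a ↔ (B p : EReal) + φ p.1 ≤ a := by
      constructor
      · rintro ⟨h1, h2⟩
        rw [← coe_toReal_of_mem hbot h1, ← EReal.coe_add]
        exact EReal.coe_le_coe_iff.2 h2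
      · intro h
        have h1 : p.1 ∈ effDomain φ := by
          refine (lt_top_iff_ne_top (a := φ p.1)).2 fun htop => ?_
          rw [htop, EReal.coe_add_top] at h
          exact absurd h (not_le.2 (EReal.coe_lt_top a))
        rw [← coe_toReal_of_mem hbot h1, ← EReal.coe_add] at h
        exact ⟨h1, EReal.coe_le_coe_iff.1 h⟩
    simp only [admissible, Set.mem_inter_iff, Set.mem_preimage, Set.mem_ofPred_eq, ← key]
    tauto
  rw [heq]
  exact ((hKcl.preimage continuous_fst).inter (hΛcl.preimage continuous_snd)).inter
    (hsum.isClosed_preimage a)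

theorem exists_joint_solution_on_ball (hX : Reflexive X) (hY : Reflexive Y)
    (hKcl : IsClosed K) (hKconv : Convex ℝ K) (hΛcl : IsClosed Λ) (hΛconv : Convex ℝ Λ)
    (hbot : ∀ x, φ x ≠ ⊥) (hφ : ERealConvex φ) (hlsc : LowerSemicontinuous φ)
    (hBconv : ConvexOn ℝ Set.univ B) (hBlsc : LowerSemicontinuous B)
    {f : X → X → ℝ} {g : Y → Y → ℝ} (hf : HasCompanion f) (hg : HasCompanion g)
    (hfconv : ∀ u, ConvexOn ℝ Set.univ (f u)) (hgconv : ∀ σ, ConvexOn ℝ Set.univ (g σ))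
    (hf0 : ∀ u, f u u = 0) (hg0 : ∀ σ, g σ σ = 0) {ρ : ℝ}
    (hne : (admissible K Λ φ ∩ Metric.closedBall 0 ρ).Nonempty) :
    ∃ p ∈ admissible K Λ φ ∩ Metric.closedBall 0 ρ,
      ∀ q ∈ admissible K Λ φ ∩ Metric.closedBall 0 ρ,
        energy B φ p ≤ f p.1 q.1 + g p.2 q.2 + energy B φ q := by
  obtain ⟨f', hff', hf'usc, hf'lim⟩ := hf
  obtain ⟨g', hgg', hg'usc, hg'lim⟩ := hg
  have hψ := convexOn_energy hKconv hΛconv hbot hφ hBconv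
  refine (hX.prod hY).exists_equilibrium (Θ := fun p q => f p.1 q.1 + g p.2 q.2)
    (Θ' := fun p q => f' p.1 q.1 + g' p.2 q.2) hne
    (Metric.isBounded_closedBall.subset Set.inter_subset_right)
    (hψ.subset Set.inter_subset_left (hψ.1.inter (convex_closedBall 0 ρ))) (fun a => ?_)
    (fun p => ((hfconv p.1).comp_linearMap (LinearMap.fst ℝ X Y)).add
      ((hgconv p.2).comp_linearMap (LinearMap.snd ℝ X Y)))
    (fun p => by simp only [hf0, hg0, add_zero])
    (fun p q => add_le_add (hff' _ _) (hgg' _ _)) (fun q p x hx ε hε => ?_) (fun p q ε hε => ?_)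
  · have : {p ∈ admissible K Λ φ ∩ Metric.closedBall 0 ρ | energy B φ p ≤ a} =
        {p ∈ admissible K Λ φ | energy B φ p ≤ a} ∩ Metric.closedBall 0 ρ := by
      ext p; simp only [Set.mem_inter_iff, Set.mem_ofPred_eq]; tauto
    rw [this]
    exact (isClosed_sublevel_energy hKcl hΛcl hbot hlsc hBlsc a).inter Metric.isClosed_closedBall
  · filter_upwards [hf'usc q.1 p.1 _ (hx.map (ContinuousLinearMap.fst ℝ X Y)) _ (half_pos hε),
      hg'usc q.2 p.2 _ (hx.map (ContinuousLinearMap.snd ℝ X Y)) _ (half_pos hε)] with n h1 h2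
    simp only [ContinuousLinearMap.coe_fst', ContinuousLinearMap.coe_snd'] at h1 h2
    linarith
  · filter_upwards [hf'lim p.1 q.1 _ (half_pos hε), hg'lim p.2 q.2 _ (half_pos hε)] with t h1 h2
    simp only [Prod.fst_add, Prod.snd_add, Prod.smul_fst, Prod.smul_snd, Prod.fst_sub,
      Prod.snd_sub]
    linarith

/-- A solution on a ball that lies in the open ball solves the whole problem. -/
theorem joint_solution_of_norm_lt (hψ : ConvexOn ℝ (admissible K Λ φ) (energy B φ))
    {f : X → X → ℝ} {g : Y → Y → ℝ}
    (hf : ∀ u d (t : ℝ), 0 ≤ t → f u (u + t • d) = t * f u (u + d))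
    (hg : ∀ σ d (t : ℝ), 0 ≤ t → g σ (σ + t • d) = t * g σ (σ + d)) {ρ : ℝ} {p : X × Y}
    (hp : p ∈ admissible K Λ φ)
    (hsol : ∀ q ∈ admissible K Λ φ ∩ Metric.closedBall 0 ρ,
        energy B φ p ≤ f p.1 q.1 + g p.2 q.2 + energy B φ q) (hpρ : ‖p‖ < ρ) :
    ∀ q ∈ admissible K Λ φ, energy B φ p ≤ f p.1 q.1 + g p.2 q.2 + energy B φ q := by
  intro q hq
  have h1 : ∀ᶠ t in 𝓝[>] (0 : ℝ), ‖p + t • (q - p)‖ < ρ :=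
    (tendsto_add_smul p (q - p)).norm.eventually_lt_const hpρ
  obtain ⟨t, htρ, ht0, ht1⟩ := (h1.and
    (Ioo_mem_nhdsGT (show (0 : ℝ) < 1 by norm_num))).exists
  have hqt : p + t • (q - p) = (1 - t) • p + t • q := by module
  have h2 := hsol (p + t • (q - p)) ⟨by
    rw [hqt]; exact hψ.1 hp hq (sub_nonneg.2 ht1.le) ht0.le (by ring), by
    rw [mem_closedBall_zero_iff]; exact htρ.le⟩
  have h3 := hψ.2 hp hq (sub_nonneg.2 ht1.le) ht0.le (by ring)
  simp only [Prod.fst_add, Prod.snd_add, Prod.smul_fst, Prod.smul_snd, Prod.fst_sub,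
    Prod.snd_sub] at h2
  rw [hf _ _ _ ht0.le, hg _ _ _ ht0.le, add_sub_cancel, add_sub_cancel, hqt] at h2
  simp only [smul_eq_mul] at h3
  have h4 : t * energy B φ p ≤ t * (f p.1 q.1 + g p.2 q.2 + energy B φ q) := by linarith
  exact le_of_mul_le_mul_left h4 ht0

variable {Z₁ Z₂ : Type*} [NormedAddCommGroup Z₁] [NormedSpace ℝ Z₁]
  [NormedAddCommGroup Z₂] [NormedSpace ℝ Z₂] {γ₁ : X →L[ℝ] Z₁} {γ₂ : Y →L[ℝ] Z₂} {J : Z₁ → ℝ}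
  {L : Z₂ → ℝ} {H : Y → ℝ} {F : X → StrongDual ℝ X} {G : Y → StrongDual ℝ Y} {α₁ α₂ : ℝ≥0}

theorem isSolution_of_joint (hJ : ∀ x, ∃ U ∈ 𝓝 x, LipschitzOnWith α₁ J U)
    (hL : ∀ x, ∃ U ∈ 𝓝 x, LipschitzOnWith α₂ L U) (hbot : ∀ x, φ x ≠ ⊥) {p : X × Y}
    (hp : p ∈ admissible K Λ φ)
    (hsol : ∀ q ∈ admissible K Λ φ, energy B φ p ≤
      bifun F (fun _ => 1) γ₁ J p.1 q.1 + bifun G H γ₂ L p.2 q.2 + energy B φ q) :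
    IsSolution K Λ B φ γ₁ γ₂ J L H F G p.1 p.2 := by
  refine ⟨⟨hp.1, hp.2.1⟩, hp.2.2, fun v hv => ?_, fun μ hμ => ?_⟩
  · by_cases hvφ : v ∈ effDomain φ
    · have h1 := hsol (v, p.2) ⟨hv, hvφ, hp.2.2⟩
      rw [bifun_self hL] at h1
      simp only [bifun, energy, one_mul, add_zero] at h1
      rw [← coe_toReal_of_mem hbot hp.2.1, ← coe_toReal_of_mem hbot hvφ, ← EReal.coe_sub,
        ← EReal.coe_add, ← EReal.coe_add, EReal.coe_le_coe_iff]
      linarith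
    · have htop : φ v = ⊤ := not_lt_top_iff.1 hvφ
      rw [htop, ← coe_toReal_of_mem hbot hp.2.1, EReal.top_sub_coe, EReal.coe_add_top,
        EReal.top_add_coe]
      exact le_top
  · have h1 := hsol (p.1, μ) ⟨hp.1, hp.2.1, hμ⟩
    rw [bifun_self hJ] at h1
    simp only [bifun, energy, zero_add] at h1
    linarith

omit [NormedSpace ℝ X] [NormedSpace ℝ Y] in
theorem norm_le_pairNorm (p : X × Y) : ‖p.1‖ ≤ pairNorm p ∧ ‖p.2‖ ≤ pairNorm p :=
  ⟨Real.le_sqrt_of_sq_le (by nlinarith [sq_nonneg ‖p.2‖]),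
    Real.le_sqrt_of_sq_le (by nlinarith [sq_nonneg ‖p.1‖])⟩

/-- Coercivity keeps the solutions on a large ball inside the open ball. -/
theorem Coercive.exists_radius (hJ : ∀ x, ∃ U ∈ 𝓝 x, LipschitzOnWith α₁ J U)
    (hL : ∀ x, ∃ U ∈ 𝓝 x, LipschitzOnWith α₂ L U) (hbot : ∀ x, φ x ≠ ⊥) (hφ : ERealConvex φ)
    (hlsc : LowerSemicontinuous φ) {m : ℝ} (hH : ∀ σ, 0 < H σ ∧ H σ < m)
    (hC : Coercive K Λ φ B F G) :
    ∃ ρ, (admissible K Λ φ ∩ Metric.closedBall 0 ρ).Nonempty ∧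
      ∀ p ∈ admissible K Λ φ ∩ Metric.closedBall 0 ρ,
        (∀ q ∈ admissible K Λ φ ∩ Metric.closedBall 0 ρ, energy B φ p ≤
          bifun F (fun _ => 1) γ₁ J p.1 q.1 + bifun G H γ₂ L p.2 q.2 + energy B φ q) →
        ‖p‖ < ρ := by
  obtain ⟨w₀, hw₀, τ₀, hτ₀, htend⟩ := hC
  obtain ⟨k, hk, hlow⟩ := exists_linear_lower_bound hbot hφ hlsc hw₀.2
  have hm : 0 ≤ m := ((hH τ₀).1.trans (hH τ₀).2).le
  obtain ⟨a, ha⟩ : ∃ a, a = k + α₁ * ‖γ₁‖ := ⟨_, rfl⟩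
  obtain ⟨b, hb⟩ : ∃ b, b = m * (α₂ * ‖γ₂‖) := ⟨_, rfl⟩
  have ha0 : 0 ≤ a := by rw [ha]; positivity
  have hb0 : 0 ≤ b := by rw [hb]; positivity
  -- The threshold collects the losses per unit of `pairNorm p`: the constant and slope of the lower
  -- bound for `φ`, and the two Clarke terms.
  have hev := htend.eventually_gt_atTop (1 + a * (1 + ‖w₀‖) + b * (1 + ‖τ₀‖))
  rw [eventually_inf_principal, eventually_comap] at hev
  obtain ⟨R, hR⟩ := eventually_atTop.1 hev
  obtain ⟨ρ, hρR, hρ1, hρ0⟩ : ∃ ρ, R ≤ ρ ∧ 1 ≤ ρ ∧ ‖(w₀, τ₀)‖ ≤ ρ :=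
    ⟨max R (max 1 ‖(w₀, τ₀)‖), le_max_left _ _, (le_max_left _ _).trans (le_max_right _ _),
      (le_max_right _ _).trans (le_max_right _ _)⟩
  have hw₀ρ : ‖w₀‖ ≤ ρ := (norm_fst_le (w₀, τ₀)).trans hρ0
  have hτ₀ρ : ‖τ₀‖ ≤ ρ := (norm_snd_le (w₀, τ₀)).trans hρ0
  refine ⟨ρ, ⟨(w₀, τ₀), ⟨hw₀.1, hw₀.2, hτ₀⟩, by simpa using hρ0⟩, fun p hp hsol => ?_⟩
  by_contra! hge
  obtain ⟨⟨hpK, hpφ, hpΛ⟩, hpρ⟩ := hp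
  rw [mem_closedBall_zero_iff] at hpρ
  obtain ⟨hn1, hn2⟩ := norm_le_pairNorm p
  have hP : ρ ≤ pairNorm p := hge.trans (by rw [Prod.norm_def]; exact max_le hn1 hn2)
  have hP1 : 1 ≤ pairNorm p := hρ1.trans hP
  have hquot := hR _ (hρR.trans hP) p rfl ⟨hpK, hpΛ⟩
  rw [lt_div_iff₀ (by linarith)] at hquot
  -- The product carries the maximum norm, so both mixed test points stay in the ball. Adding the
  -- two tests bounds the coercivity numerator from above and contradicts `hquot`.
  have h1 := hsol (w₀, p.2) ⟨⟨hw₀.1, hw₀.2, hpΛ⟩, by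
    rw [mem_closedBall_zero_iff, Prod.norm_def]
    exact max_le hw₀ρ ((norm_snd_le p).trans hpρ)⟩
  have h2 := hsol (p.1, τ₀) ⟨⟨hpK, hpφ, hτ₀⟩, by
    rw [mem_closedBall_zero_iff, Prod.norm_def]
    exact max_le ((norm_fst_le p).trans hpρ) hτ₀ρ⟩
  rw [bifun_self hL] at h1
  rw [bifun_self hJ] at h2
  simp only [bifun, energy, one_mul, add_zero, zero_add] at h1 h2
  have h3 := hlow p.1 hpφ
  have h4 : clarkeDeriv J (γ₁ p.1) (γ₁ (w₀ - p.1)) ≤ α₁ * ‖γ₁‖ * ‖p.1 - w₀‖ := by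
    refine ((abs_le.1 (abs_clarkeDeriv_le hJ _ _)).2).trans ?_
    rw [mul_assoc, norm_sub_rev p.1]
    gcongr
    exact γ₁.le_opNorm _
  have h5 : H p.2 * clarkeDeriv L (γ₂ p.2) (γ₂ (τ₀ - p.2)) ≤ b * ‖p.2 - τ₀‖ := by
    have h6 : clarkeDeriv L (γ₂ p.2) (γ₂ (τ₀ - p.2)) ≤ α₂ * ‖γ₂‖ * ‖p.2 - τ₀‖ := by
      refine ((abs_le.1 (abs_clarkeDeriv_le hL _ _)).2).trans ?_
      rw [mul_assoc, norm_sub_rev p.2]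
      gcongr
      exact γ₂.le_opNorm _
    calc _ ≤ H p.2 * (α₂ * ‖γ₂‖ * ‖p.2 - τ₀‖) := mul_le_mul_of_nonneg_left h6 (hH _).1.le
      _ ≤ m * (α₂ * ‖γ₂‖ * ‖p.2 - τ₀‖) :=
        mul_le_mul_of_nonneg_right (hH _).2.le (by positivity)
      _ = b * ‖p.2 - τ₀‖ := by rw [hb]; ring
  have h7 : ‖p.1 - w₀‖ ≤ pairNorm p * (1 + ‖w₀‖) := by
    nlinarith [norm_sub_le p.1 w₀, mul_nonneg (sub_nonneg.2 hP1) (norm_nonneg w₀)]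
  have h8 : ‖p.2 - τ₀‖ ≤ pairNorm p * (1 + ‖τ₀‖) := by
    nlinarith [norm_sub_le p.2 τ₀, mul_nonneg (sub_nonneg.2 hP1) (norm_nonneg τ₀)]
  have h9 := mul_le_mul_of_nonneg_left h7 ha0
  have h10 := mul_le_mul_of_nonneg_left h8 hb0
  have h11 : a * ‖p.1 - w₀‖ = k * ‖p.1 - w₀‖ + α₁ * ‖γ₁‖ * ‖p.1 - w₀‖ := by rw [ha]; ring
  have hB : B p = B (p.1, p.2) := rfl
  linarith

end Main

end CoupledIneq

theorem mainTheorem3 {X Y Z₁ Z₂ : Type*}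
    [NormedAddCommGroup X] [NormedSpace ℝ X] [CompleteSpace X]
    [NormedAddCommGroup Y] [NormedSpace ℝ Y] [CompleteSpace Y]
    [NormedAddCommGroup Z₁] [NormedSpace ℝ Z₁] [CompleteSpace Z₁]
    [NormedAddCommGroup Z₂] [NormedSpace ℝ Z₂] [CompleteSpace Z₂]
    (hX : CoupledIneq.Reflexive X) (hY : CoupledIneq.Reflexive Y)
    (K : Set X) (hKne : K.Nonempty) (hKcl : IsClosed K) (hKconv : Convex ℝ K)
    (Λ : Set Y) (hΛne : Λ.Nonempty) (hΛcl : IsClosed Λ) (hΛconv : Convex ℝ Λ)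
    (B : X × Y → ℝ) (φ : X → EReal)
    (γ₁ : X →L[ℝ] Z₁) (γ₂ : Y →L[ℝ] Z₂) (J : Z₁ → ℝ) (L : Z₂ → ℝ) (H : Y → ℝ)
    (F : X → StrongDual ℝ X) (G : Y → StrongDual ℝ Y)
    (hφbot : ∀ x, φ x ≠ ⊥) (hφconv : CoupledIneq.ERealConvex φ)
    (hφlsc : LowerSemicontinuous φ) (hφK : (CoupledIneq.effDomain φ ∩ K).Nonempty)
    (hJ : CoupledIneq.BoundedLocalLipschitz J) (hL : CoupledIneq.BoundedLocalLipschitz L)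
    (hγ₁ : IsCompactOperator γ₁) (hγ₂ : IsCompactOperator γ₂)
    (hHbd : ∃ m : ℝ, 0 < m ∧ ∀ σ, 0 < H σ ∧ H σ < m)
    (hHcont : ∀ (σ : Y) (s : ℕ → Y), CoupledIneq.WeaklyTendsto s σ →
      Tendsto (fun n => H (s n)) atTop (𝓝 (H σ)))
    (hBconv : ConvexOn ℝ Set.univ B) (hBlsc : LowerSemicontinuous B)
    (hF : CoupledIneq.OpCond1 F ∨ CoupledIneq.OpCond2 F ∨
      CoupledIneq.OpCond3 F (fun _ => 1) γ₁ J)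
    (hG : CoupledIneq.OpCond1 G ∨ CoupledIneq.OpCond2 G ∨ CoupledIneq.OpCond3 G H γ₂ L)
    (hKΛ : Bornology.IsBounded (K ×ˢ Λ) ∨ CoupledIneq.Coercive K Λ φ B F G) :
    ∃ (u : X) (σ : Y), CoupledIneq.IsSolution K Λ B φ γ₁ γ₂ J L H F G u σ := by
  obtain ⟨α₁, hJ⟩ := hJ.exists_const
  obtain ⟨α₂, hL⟩ := hL.exists_const
  obtain ⟨m, -, hH⟩ := hHbd
  have hH0 : ∀ σ, 0 < H σ := fun σ => (hH σ).1
  have h1 : ∀ u : X, (0 : ℝ) < 1 := fun _ => one_pos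
  have hFcomp : CoupledIneq.HasCompanion (CoupledIneq.bifun F (fun _ => 1) γ₁ J) := by
    rcases hF with hF | hF | hF
    · exact hF.hasCompanion hJ hγ₁ h1 fun _ _ _ => tendsto_const_nhds
    · exact hF.hasCompanion hJ hγ₁ h1 fun _ _ _ => tendsto_const_nhds
    · exact hF.hasCompanion hJ hγ₁ h1 fun _ _ _ => tendsto_const_nhds
  have hGcomp : CoupledIneq.HasCompanion (CoupledIneq.bifun G H γ₂ L) := by
    rcases hG with hG | hG | hG
    · exact hG.hasCompanion hL hγ₂ hH0 hHcont
    · exact hG.hasCompanion hL hγ₂ hH0 hHcont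
    · exact hG.hasCompanion hL hγ₂ hH0 hHcont
  obtain ⟨ρ, hne, hρ⟩ : ∃ ρ, (CoupledIneq.admissible K Λ φ ∩ Metric.closedBall 0 ρ).Nonempty ∧
      ∀ p ∈ CoupledIneq.admissible K Λ φ ∩ Metric.closedBall 0 ρ,
        (∀ q ∈ CoupledIneq.admissible K Λ φ ∩ Metric.closedBall 0 ρ, CoupledIneq.energy B φ p ≤
          CoupledIneq.bifun F (fun _ => 1) γ₁ J p.1 q.1 + CoupledIneq.bifun G H γ₂ L p.2 q.2 +
            CoupledIneq.energy B φ q) → ‖p‖ < ρ := by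
    rcases hKΛ with hbd | hC
    · obtain ⟨R, hR⟩ := hbd.exists_norm_le
      obtain ⟨u, huφ, huK⟩ := hφK
      obtain ⟨σ, hσ⟩ := hΛne
      -- The extra `1` puts every admissible pair in the open ball.
      refine ⟨R + 1, ⟨(u, σ), ⟨huK, huφ, hσ⟩, ?_⟩, fun p hp _ => ?_⟩
      · rw [mem_closedBall_zero_iff]
        linarith [hR (u, σ) ⟨huK, hσ⟩]
      · linarith [hR p ⟨hp.1.1, hp.1.2.2⟩]
    · exact hC.exists_radius hJ hL hφbot hφconv hφlsc hH
  obtain ⟨p, hp, hsol⟩ := CoupledIneq.exists_joint_solution_on_ball hX hY hKcl hKconv hΛcl hΛconv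
    hφbot hφconv hφlsc hBconv hBlsc hFcomp hGcomp (CoupledIneq.convexOn_bifun hJ h1)
    (CoupledIneq.convexOn_bifun hL hH0) (CoupledIneq.bifun_self hJ) (CoupledIneq.bifun_self hL) hne
  exact ⟨p.1, p.2, CoupledIneq.isSolution_of_joint hJ hL hφbot hp.1
    (CoupledIneq.joint_solution_of_norm_lt
      (CoupledIneq.convexOn_energy hKconv hΛconv hφbot hφconv hBconv)
      (fun u d t ht => CoupledIneq.bifun_add_smul hJ u d ht)
      (fun σ d t ht => CoupledIneq.bifun_add_smul hL σ d ht) hp.1 hsol (hρ p hp hsol))⟩
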